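/- For complex $a_1,a_2,a_3,b_1,b_2$ with $b_1,b_2\notin\{0,-1,-2,\dots\}$ let $${}_3F_2(a_1,a_2,a_3;b_1,b_2\,|\,1)=\sum_{k\ge 0}\frac{(a_1)_k(a_2)_k(a_3)_k}{(b_1)_k(b_2)_k\,k!},$$ with parametric excess $s=b_1+b_2-a_1-a_2-a_3$. For integers $m,n$ let $X_{m,n}(a,b,c)={}_3F_2(a,b,c;\,1+m+a-b,\,1+m+n+a-c\,|\,1)$ (contiguous to Dixon's theorem, $m=n=0$) and $P_{m,n}(a,b,c)={}_3F_2(a,b,1-b+m+n;\,c,\,1+2a+m-c\,|\,1)$ (contiguous to Whipple's theorem, $m=n=0$). For complex $a,b,c$ one has the following closed forms, where $1/\Gamma$ is read as $0$ at the poles of $\Gamma$. (1) ${}_3F_2(a,b,c;b+2-a,1+b-c\,|\,1)=X_{0,1}(b,c,a)$ equals $$-\frac{\Gamma(b+2-a)\Gamma(1+b-c)\Gamma(\frac b2-c-a+2)\sqrt\pi}{2^b(a-1)\Gamma(1-a+\frac b2)\Gamma(\frac b2-c+1)\Gamma(\frac b2+\frac12)\Gamma(b+2-a-c)}+\frac{\Gamma(b+2-a)\Gamma(1+b-c)\Gamma(\frac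 b2-c-a+\frac32)\sqrt\pi}{2^b(a-1)\Gamma(b+2-a-c)\Gamma(\frac b2)\Gamma(\frac b2+\frac32-a)\Gamma(\frac12+\frac b2-c)}.$$ (2) ${}_3F_2(a,b,2-b;c,2a+2-c\,|\,1)=P_{1,0}(a,b,c)$ equals $$\frac{\Gamma(2a+2-c)\Gamma(c)}{2(1-b)(a+1-c)\Gamma(b+c-2)\Gamma(2+2a-b-c)}\left(\frac{\Gamma(a-\frac c2+1-\frac b2)\Gamma(\frac b2+\frac c2-1)}{\Gamma(a+\frac b2-\frac c2)\Gamma(\frac c2-\frac b2)}-\frac{\Gamma(\frac32+a-\frac b2-\frac c2)\Gamma(\frac b2+\frac c2-\frac12)}{\Gamma(a-\frac c2+\frac12+\frac b2)\Gamma(\frac c2-\frac b2+\frac12)}\right).$$ (3) ${}_3F_2(a,b,1-b;c,2a-c\,|\,1)=P_{-1,1}(a,b,c)$ equals $$\frac{\sqrt\pi\,\Gamma(a-1)\Gamma(c)\Gamma(2a-c)}{2^{2a-b-c}\,\Gamma(a)\Gamma(b+c-1)}\left(\frac{\Gamma(\frac b2+\frac c2-\frac12)}{\Gamma(\frac c2-\frac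 b2+\frac12)\Gamma(a-\frac b2-\frac c2)\Gamma(a+\frac b2-\frac c2-\frac12)}+\frac{\Gamma(\frac b2+\frac c2)}{\Gamma(\frac c2-\frac b2)\Gamma(a-\frac b2-\frac c2+\frac12)\Gamma(a+\frac b2-\frac c2)}\right).$$ (4) ${}_3F_2(a,b,-b;c,2a-c+1\,|\,1)=P_{0,-1}(a,b,c)$ equals $$\frac{\sqrt\pi\,\Gamma(2a-c+1)\Gamma(c)}{2^{2a-c+1-b}\,\Gamma(b+c)}\left(\frac{\Gamma(\frac b2+\frac c2)}{\Gamma(a-\frac c2+1+\frac b2)\Gamma(a-\frac b2-\frac c2+\frac12)\Gamma(\frac c2-\frac b2)}+\frac{\Gamma(\frac b2+\frac c2+\frac12)}{\Gamma(a-\frac c2+\frac12+\frac b2)\Gamma(a-\frac c2+1-\frac b2)\Gamma(\frac c2-\frac b2+\frac12)}\right).$$ (5) ${}_3F_2(a,1-a,b;c,2+2b-c\,|\,1)=P_{1,-1}(b,a,c)$ equals $$\frac{\pi\,2^{-2b}\,\Gamma(2+2b-c)\Gamma(c)}{c-1-b}\left(\frac{1}{\Gamma(\frac a2-\frac c2+1+b)\Gamma(\frac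 c2-\frac a2)\Gamma(\frac c2+\frac a2-\frac12)\Gamma(\frac32-\frac c2-\frac a2+b)}-\frac{1}{\Gamma(\frac12+\frac a2-\frac c2+b)\Gamma(1+b-\frac c2-\frac a2)\Gamma(\frac c2+\frac a2)\Gamma(\frac c2-\frac a2+\frac12)}\right).$$ For each of the five formulas let $D\subset\mathbb C^3$ be the set of all $(a,b,c)$ at which no gamma function in a numerator of the right-hand side has a pole and no explicit linear factor in a denominator vanishes. Then $D$ is open and connected and contains points with $\operatorname{Re}s>0$; the right-hand side is analytic on $D$; and at every point of $D$ with $\operatorname{Re}s>0$ the series converges absolutely and the formula holds. So the right-hand side is the analytic continuation of the sum to all of $D$. Moreover, the formula holds for the terminating series at every point of $D$, whatever $s$, at which one of the following numbers lies in $\{0,-1,-2,\dots\}$: $a$, $b$ or $c$ in (1); $b$ or $2-b$ in (2); $b$ or $1-b$ in (3); $b$ or $-b$ in (4); $a$ or $1-a$ in (5). -/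

import Mathlib

open Complex (Gamma)

/-- The parameters of a hypergeometric series `₃F₂(a₁, a₂, a₃; b₁, b₂ | 1)`. -/
structure HypParams where
  a₁ : ℂ
  a₂ : ℂ
  a₃ : ℂ
  b₁ : ℂ
  b₂ : ℂ

/-- The `k`-th term `(a₁)ₖ (a₂)ₖ (a₃)ₖ / ((b₁)ₖ (b₂)ₖ k!)` of `₃F₂(a₁, a₂, a₃; b₁, b₂ | 1)`. -/
noncomputable def HypParams.term (p : HypParams) (k : ℕ) : ℂ :=
  ((ascPochhammer ℂ k).eval p.a₁ * (ascPochhammer ℂ k).eval p.a₂ * (ascPochhammer ℂ k).eval p.a₃) /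
    ((ascPochhammer ℂ k).eval p.b₁ * (ascPochhammer ℂ k).eval p.b₂ * (k.factorial : ℂ))

/-- The parametric excess `b₁ + b₂ - a₁ - a₂ - a₃`. -/
def HypParams.excess (p : HypParams) : ℂ :=
  p.b₁ + p.b₂ - p.a₁ - p.a₂ - p.a₃

/-- The parameters of the element `X_{m,n}(a, b, c)` contiguous to Dixon's theorem. -/
noncomputable def dixonElement (a b c : ℂ) (m n : ℤ) : HypParams where
  a₁ := a
  a₂ := b
  a₃ := c
  b₁ := 1 + m + a - b
  b₂ := 1 + m + n + a - c

/-- The parameters of the element `P_{m,n}(a, b, c)` contiguous to Whipple's theorem. -/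
noncomputable def whippleElement (a b c : ℂ) (m n : ℤ) : HypParams where
  a₁ := a
  a₂ := b
  a₃ := 1 - b + m + n
  b₁ := c
  b₂ := 1 + 2 * a + m - c

/-- `z` is one of `0, -1, -2, …`, the poles of the gamma function. -/
def IsGammaPole (z : ℂ) : Prop := ∃ n : ℕ, z = -(n : ℂ)

/-- `R` is a closed form, on the domain `D` in the space of `(a, b, c)`, of the family
`₃F₂(P a b c | 1)`:
* at every point of `D` at which the parametric excess has positive real part, the series converges
  (absolutely) and has the sum `R`; the same holds, whatever the excess, at the points of `D` that
  satisfy `T` (used for terminating series);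
* `D` is open and connected and has points at which the excess has positive real part, and `R` is
  analytic on `D`: so `R` is the analytic continuation of the sum of the series to all of `D`. -/
def IsClosedForm (P : ℂ → ℂ → ℂ → HypParams) (D T : ℂ → ℂ → ℂ → Prop) (R : ℂ → ℂ → ℂ → ℂ) : Prop :=
  (∀ a b c : ℂ, D a b c → (0 < (P a b c).excess.re ∨ T a b c) →
    HasSum (P a b c).term (R a b c)) ∧
  IsOpen {x : ℂ × ℂ × ℂ | D x.1 x.2.1 x.2.2} ∧
  IsConnected {x : ℂ × ℂ × ℂ | D x.1 x.2.1 x.2.2} ∧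
  (∃ a b c : ℂ, D a b c ∧ 0 < (P a b c).excess.re) ∧
  AnalyticOnNhd ℂ (fun x : ℂ × ℂ × ℂ => R x.1 x.2.1 x.2.2) {x : ℂ × ℂ × ℂ | D x.1 x.2.1 x.2.2}

/-!
Every one of the five series is a combination of two series that are summed by Dixon's or Whipple's
theorem, so the proof has three parts.

*The theorems of Dixon and Whipple* (`hasSum_dixon`, `hasSum_whipple`). The terms of the series
satisfy Gosper-type relations (`dixon_telescope`, `whipple_telescope`): a multiple of the term,
minus a multiple of the term with some parameters raised, is a difference `G (k + 1) - G k`. Since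
the `k`-th term is of order `k ^ (-s - 1)` for the excess `s` (`term_isBigO`), or vanishes
eventually, the remainder `G` tends to zero, and the sum is a rational function times the sum with
raised parameters. When this is iterated the sums tend to `1` by dominated convergence
(`tendsto_tsum_shift`), and the product of the rational functions is a quotient of Pochhammer
symbols, which by Euler's limit for `1 / Γ` tends to the stated product of gamma functions
(`tendsto_prod_poch_div`). No continuation in the parameters is needed, and terminating series are
treated by the same argument. The exception is a Dixon series that terminates because of its
parameter `a`: raising `a` may destroy the convergence, but there the iteration ends at `a = 0` or
`a = -1`, where the sum is known.

*The contiguous series* (`hasSum_dixonContiguous` and the lemmas `hasSum_whippleContiguous_*`). The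
combination of two known series is again a telescoping relation or a termwise identity. For
`P_{0,-1}` and `P_{1,-1}` the two series of Whipple's form may diverge although the given series
converges. Raising their parameters by `whipple_telescope` makes them converge, and the leading
parts of the two remainders cancel. The value `whippleRegValue` is that of Whipple's series with the
lower parameter `c - 1`, times `c - 1`; it has no singularity at `c = 1`.

*The domain.* Each domain is the complement of a locally finite union of complex hyperplanes. Such a
set is connected, since two of its points lie on a complex line from which only countably many
points are removed (`IsLineDense.isConnected`). On it the closed form is analytic, because `1 / Γ`
is entire.
-/

open Filter Topology Asymptotics

/-! ### Pochhammer symbols and the growth of the terms -/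

/-- The Pochhammer symbol `(x)ₖ = x (x + 1) ⋯ (x + k - 1)`. -/
noncomputable def poch (x : ℂ) (k : ℕ) : ℂ := (ascPochhammer ℂ k).eval x

lemma poch_zero (x : ℂ) : poch x 0 = 1 := by simp [poch]

lemma poch_succ (x : ℂ) (k : ℕ) : poch x (k + 1) = poch x k * (x + k) :=
  ascPochhammer_succ_eval k x

lemma poch_succ_left (x : ℂ) (k : ℕ) : poch x (k + 1) = x * poch (x + 1) k := by
  induction k with
  | zero => simp [poch_succ, poch_zero]
  | succ k ih => rw [poch_succ, ih, poch_succ]; push_cast; ring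

lemma poch_eq_prod (x : ℂ) (k : ℕ) : poch x k = ∏ j ∈ Finset.range k, (x + j) := by
  induction k with
  | zero => simp [poch_zero]
  | succ k ih => rw [poch_succ, ih, Finset.prod_range_succ]

lemma add_natCast_ne_zero {x : ℂ} (hx : ¬ IsGammaPole x) (k : ℕ) : x + k ≠ 0 :=
  fun h => hx ⟨k, eq_neg_of_add_eq_zero_left h⟩

lemma IsGammaPole.of_add_natCast {x : ℂ} (k : ℕ) (h : IsGammaPole (x + k)) : IsGammaPole x := by
  obtain ⟨n, hn⟩ := h
  exact ⟨n + k, by push_cast; linear_combination hn⟩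

lemma poch_ne_zero {x : ℂ} (hx : ¬ IsGammaPole x) (k : ℕ) : poch x k ≠ 0 := by
  rw [poch_eq_prod, Finset.prod_ne_zero_iff]
  exact fun j _ => add_natCast_ne_zero hx j

lemma poch_neg_natCast {n k : ℕ} (h : n < k) : poch (-(n : ℂ)) k = 0 := by
  rw [poch_eq_prod, Finset.prod_eq_zero_iff]
  exact ⟨n, Finset.mem_range.2 h, by simp⟩

lemma gamma_ne_zero {x : ℂ} (hx : ¬ IsGammaPole x) : Gamma x ≠ 0 :=
  Complex.Gamma_ne_zero fun m h => hx ⟨m, h⟩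

/-- Euler's limit for `1 / Γ`, which holds at the poles of `Γ` too. -/
lemma tendsto_poch (x : ℂ) :
    Tendsto (fun n : ℕ => poch x n * n / (n.factorial * (n : ℂ) ^ x)) atTop (𝓝 (Gamma x)⁻¹) := by
  have h1 : Tendsto (fun n : ℕ => (Complex.GammaSeq x n)⁻¹) atTop (𝓝 (Gamma x)⁻¹) := by
    by_cases hx : IsGammaPole x
    · obtain ⟨m, rfl⟩ := hx
      rw [Complex.Gamma_neg_nat_eq_zero, inv_zero]
      refine tendsto_const_nhds.congr' ?_
      filter_upwards [eventually_ge_atTop m] with n hn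
      rw [Complex.GammaSeq, ← poch_eq_prod, poch_neg_natCast (by omega)]
      simp
    · exact (Complex.GammaSeq_tendsto_Gamma x).inv₀ (gamma_ne_zero hx)
  have h2 := h1.mul (tendsto_natCast_div_add_atTop x)
  rw [mul_one] at h2
  refine h2.congr' ?_
  have h3 : ∀ᶠ n : ℕ in atTop, (n : ℂ) + x ≠ 0 := by
    by_cases hx : IsGammaPole x
    · obtain ⟨m, rfl⟩ := hx
      filter_upwards [eventually_gt_atTop m] with n hn
      rw [← sub_eq_add_neg, sub_ne_zero]
      exact_mod_cast hn.ne'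
    · exact Eventually.of_forall fun n => by rw [add_comm]; exact add_natCast_ne_zero hx n
  filter_upwards [h3] with n hn
  rw [Complex.GammaSeq, ← poch_eq_prod, poch_succ, inv_div, add_comm x]
  field_simp

lemma term_eq (p : HypParams) (k : ℕ) :
    p.term k = poch p.a₁ k * poch p.a₂ k * poch p.a₃ k /
      (poch p.b₁ k * poch p.b₂ k * k.factorial) := rfl

/-- The `k`-th term of `₃F₂(1)` is of order `k ^ (-s - 1)`, where `s` is the excess. -/
lemma term_isBigO (p : HypParams) (h₁ : ¬ IsGammaPole p.b₁) (h₂ : ¬ IsGammaPole p.b₂) :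
    p.term =O[atTop] fun k : ℕ => (k : ℝ) ^ (-p.excess.re - 1) := by
  have hlim := (((tendsto_poch p.a₁).mul (tendsto_poch p.a₂)).mul (tendsto_poch p.a₃)).div
    ((tendsto_poch p.b₁).mul (tendsto_poch p.b₂))
    (mul_ne_zero (inv_ne_zero (gamma_ne_zero h₁)) (inv_ne_zero (gamma_ne_zero h₂)))
  have hO := hlim.isBigO_one ℝ
  have hpow : (fun k : ℕ => (k : ℂ) ^ (-p.excess - 1)) =O[atTop]
      fun k : ℕ => (k : ℝ) ^ (-p.excess.re - 1) := by
    refine IsBigO.of_bound 1 ?_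
    filter_upwards [eventually_gt_atTop 0] with k hk
    rw [Complex.norm_natCast_cpow_of_pos hk, one_mul]
    simpa using le_abs_self _
  have hmul := hO.mul hpow
  simp only [one_mul] at hmul
  refine hmul.congr' ?_ EventuallyEq.rfl
  filter_upwards [eventually_gt_atTop 0] with k hk
  have hkC : (k : ℂ) ≠ 0 := by exact_mod_cast hk.ne'
  have hpow : ∀ x : ℂ, (k : ℂ) ^ x ≠ 0 := fun x => by simp [Complex.cpow_eq_zero_iff, hkC]
  have hf : (k.factorial : ℂ) ≠ 0 := by exact_mod_cast k.factorial_ne_zero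
  have e : (k : ℂ) ^ (-p.excess - 1) =
      (k : ℂ) ^ p.a₁ * (k : ℂ) ^ p.a₂ * (k : ℂ) ^ p.a₃ / ((k : ℂ) ^ p.b₁ * (k : ℂ) ^ p.b₂ * k) := by
    rw [eq_div_iff (by simp [hkC, hpow])]
    nth_rewrite 4 [← Complex.cpow_one (k : ℂ)]
    simp only [← Complex.cpow_add _ _ hkC]
    congr 1
    simp only [HypParams.excess]; ring
  rw [e, term_eq, Pi.div_apply]
  have := poch_ne_zero h₁ k
  have := poch_ne_zero h₂ k
  have := hpow p.a₁
  have := hpow p.a₂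
  have := hpow p.a₃
  have := hpow p.b₁
  have := hpow p.b₂
  field_simp

lemma summable_term {p : HypParams} (h₁ : ¬ IsGammaPole p.b₁) (h₂ : ¬ IsGammaPole p.b₂)
    (hs : 0 < p.excess.re) : Summable p.term :=
  summable_of_isBigO_nat (Real.summable_nat_rpow.2 (by linarith)) (term_isBigO p h₁ h₂)

/-- The series with parameters `p` terminates. -/
def HypParams.Terminates (p : HypParams) : Prop :=
  IsGammaPole p.a₁ ∨ IsGammaPole p.a₂ ∨ IsGammaPole p.a₃

lemma HypParams.Terminates.eventually_eq_zero {p : HypParams} (h : p.Terminates) :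
    ∀ᶠ k in atTop, p.term k = 0 := by
  rcases h with ⟨n, hn⟩ | ⟨n, hn⟩ | ⟨n, hn⟩ <;>
  · filter_upwards [eventually_gt_atTop n] with k hk
    simp [term_eq, hn, poch_neg_natCast hk]

lemma HypParams.Terminates.summable {p : HypParams} (h : p.Terminates) : Summable p.term := by
  obtain ⟨N, hN⟩ := eventually_atTop.1 h.eventually_eq_zero
  refine summable_of_ne_finset_zero (s := Finset.range N) fun k hk => hN k ?_
  simpa using hk

/-- A factor of order `k ^ m` times the `k`-th term tends to zero, if `m < Re s + 1` or the
series terminates. -/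
lemma tendsto_mul_term {p : HypParams} (h₁ : ¬ IsGammaPole p.b₁) (h₂ : ¬ IsGammaPole p.b₂)
    {m : ℕ} (hp : (m : ℝ) < p.excess.re + 1 ∨ p.Terminates) {f : ℕ → ℂ}
    (hf : f =O[atTop] fun k : ℕ => (k : ℝ) ^ m) :
    Tendsto (fun k => f k * p.term k) atTop (𝓝 0) := by
  rcases hp with hs | ht
  · refine (hf.mul (term_isBigO p h₁ h₂)).trans_tendsto ?_
    have h : Tendsto (fun k : ℕ => (k : ℝ) ^ (-(p.excess.re + 1 - m))) atTop (𝓝 0) :=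
      (tendsto_rpow_neg_atTop (by linarith)).comp tendsto_natCast_atTop_atTop
    refine h.congr' ?_
    filter_upwards [eventually_gt_atTop 0] with k hk
    rw [← Real.rpow_natCast, ← Real.rpow_add (by exact_mod_cast hk)]
    congr 1; ring
  · refine tendsto_const_nhds.congr' ?_
    filter_upwards [ht.eventually_eq_zero] with k hk
    simp [hk]

lemma isBigO_add_natCast (x : ℂ) : (fun k : ℕ => x + k) =O[atTop] fun k : ℕ => (k : ℝ) := by
  refine IsBigO.add (IsBigO.of_bound ‖x‖ ?_) (IsBigO.of_bound 1 (by simp))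
  filter_upwards [eventually_ge_atTop 1] with k hk
  have : (1 : ℝ) ≤ k := by exact_mod_cast hk
  simpa using le_mul_of_one_le_right (norm_nonneg x) this

lemma hasSum_of_tendsto_sum_range {f : ℕ → ℂ} {S : ℂ} (hf : Summable f)
    (h : Tendsto (fun N => ∑ k ∈ Finset.range N, f k) atTop (𝓝 S)) : HasSum f S :=
  tendsto_nhds_unique hf.hasSum.tendsto_sum_nat h ▸ hf.hasSum

/-! ### Large parameters -/

/-- The quotient of consecutive terms. -/
lemma term_succ (p : HypParams) (k : ℕ) :
    p.term (k + 1) = p.term k * ((p.a₁ + k) * (p.a₂ + k) * (p.a₃ + k) /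
      ((p.b₁ + k) * (p.b₂ + k) * (k + 1))) := by
  simp only [term_eq, poch_succ, Nat.factorial_succ]
  push_cast
  rw [div_mul_div_comm]
  congr 1 <;> ring

lemma term_zero (p : HypParams) : p.term 0 = 1 := by simp [term_eq, poch_zero]

/-- A bound for the quotient of consecutive terms that decreases with the shift `2 n`. It holds as
`(x + j + B) (x + j - 3 B) ≤ (x + j - B) ^ 2`. -/
lemma norm_ratio_le {B x : ℝ} {a b c u v : ℂ} (ha : ‖a‖ ≤ B) (hb : ‖b‖ ≤ B) (hc : ‖c‖ ≤ B)
    (hu : ‖u‖ ≤ B) (hv : ‖v‖ ≤ B) (j n : ℕ) (hx : x = 2 * n) (hB : 3 * B < x) :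
    ‖((a + 2 * n) + j) * (b + j) * (c + j) / (((u + 2 * n) + j) * ((v + 2 * n) + j) * (j + 1))‖ ≤
      (j + B) ^ 2 / ((j + x - 3 * B) * (j + 1)) := by
  have hB0 : 0 ≤ B := (norm_nonneg a).trans ha
  have hj : (0 : ℝ) ≤ j := j.cast_nonneg
  have hup : ∀ z : ℂ, ‖z‖ ≤ B → ‖z + j‖ ≤ j + B := fun z hz => by
    refine (norm_add_le _ _).trans ?_
    simp; linarith
  have e : ‖(2 * n + j : ℂ)‖ = x + j := by
    rw [hx, show (2 * n + j : ℂ) = ((2 * n + j : ℕ) : ℂ) by push_cast; ring, Complex.norm_natCast]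
    push_cast; ring
  have hup' : ‖(a + 2 * n) + j‖ ≤ x + j + B := by
    rw [add_assoc]
    exact (norm_add_le _ _).trans (by linarith)
  have hlow : ∀ z : ℂ, ‖z‖ ≤ B → x + j - B ≤ ‖(z + 2 * n) + j‖ := fun z hz => by
    have := norm_sub_le ((z + 2 * n) + j) z
    rw [show (z + 2 * n) + j - z = (2 * n + j : ℂ) by ring, e] at this
    linarith
  have hj1 : ‖(j + 1 : ℂ)‖ = j + 1 := by exact_mod_cast Complex.norm_natCast (j + 1)
  simp only [norm_div, norm_mul, hj1]
  have h1 : 0 < x + j - B := by linarith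
  calc _ ≤ (x + j + B) * (j + B) * (j + B) / ((x + j - B) * (x + j - B) * (j + 1)) := by
        have := hup b hb
        have := hup c hc
        have := hlow u hu
        have := hlow v hv
        have : 0 ≤ x + j + B := by linarith
        have : 0 ≤ j + B := by linarith
        gcongr
    _ ≤ _ := by
        have h2 : 0 < (j + x - 3 * B) := by linarith
        rw [div_le_div_iff₀ (by positivity) (by positivity)]
        have h3 : (x + j + B) * (j + x - 3 * B) ≤ (x + j - B) * (x + j - B) := by nlinarith
        have h4 : 0 ≤ (j + B) ^ 2 * (j + 1) := by positivity
        nlinarith [mul_le_mul_of_nonneg_left h3 h4]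

/-- The sum of `₃F₂(a + 2n, b, c; u + 2n, v + 2n | 1)` tends to `1`: once `n` is large, the terms
are at most `2 / ((k + 1) (k + 2))`, and each but the first tends to zero. -/
lemma tendsto_tsum_shift (a b c u v : ℂ) :
    Tendsto (fun n : ℕ => ∑' k, HypParams.term ⟨a + 2 * n, b, c, u + 2 * n, v + 2 * n⟩ k)
      atTop (𝓝 1) := by
  obtain ⟨B, hB1, ha, hb, hc, hu, hv⟩ : ∃ B : ℝ, 1 ≤ B ∧ ‖a‖ ≤ B ∧ ‖b‖ ≤ B ∧ ‖c‖ ≤ B ∧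
      ‖u‖ ≤ B ∧ ‖v‖ ≤ B := by
    refine ⟨1 + ‖a‖ + ‖b‖ + ‖c‖ + ‖u‖ + ‖v‖, ?_⟩
    have := norm_nonneg a
    have := norm_nonneg b
    have := norm_nonneg c
    have := norm_nonneg u
    have := norm_nonneg v
    refine ⟨?_, ?_, ?_, ?_, ?_, ?_⟩ <;> linarith
  -- For `2 n > K` the quotient of consecutive terms is at most `(k + 1) / (k + 3)`, because
  -- `(k + B) ^ 2 (k + 3) ≤ (k + 1) ^ 2 (k + K - 3 B)`.
  set K : ℝ := 3 * B + 3 + 6 * (B - 1) + 3 * (B - 1) ^ 2 with hK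
  have hlarge : ∀ᶠ n : ℕ in atTop, K < 2 * (n : ℝ) :=
    (tendsto_natCast_atTop_atTop.const_mul_atTop two_pos).eventually_gt_atTop K
  have hK3 : 3 * B < K := by nlinarith [sq_nonneg (B - 1)]
  have hbound : ∀ n : ℕ, K < 2 * (n : ℝ) → ∀ k : ℕ,
      ‖HypParams.term ⟨a + 2 * n, b, c, u + 2 * n, v + 2 * n⟩ k‖ ≤
        2 / (((k : ℝ) + 1) * (k + 2)) := by
    intro n hn k
    induction k with
    | zero => simp [term_zero]
    | succ k ih =>
      rw [term_succ, norm_mul]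
      have hr := norm_ratio_le ha hb hc hu hv k n rfl (hK3.trans hn)
      have hk : (0 : ℝ) ≤ k := k.cast_nonneg
      have hr2 : ((k : ℝ) + B) ^ 2 / ((k + 2 * n - 3 * B) * (k + 1)) ≤ (k + 1) / (k + 3) := by
        have : 0 < (k : ℝ) + 2 * n - 3 * B := by linarith
        rw [div_le_div_iff₀ (by positivity) (by positivity)]
        have h1 : ((k : ℝ) + B) ^ 2 * (k + 3) ≤
            (k + 1) ^ 2 * (k + 3 + 6 * (B - 1) + 3 * (B - 1) ^ 2) := by
          have hd : 0 ≤ B - 1 := by linarith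
          nlinarith [mul_nonneg hd hk, mul_nonneg (mul_nonneg hd hk) hk,
            mul_nonneg (sq_nonneg (B - 1)) hk, mul_nonneg (sq_nonneg (B - 1)) (sq_nonneg (k : ℝ))]
        have h2 : ((k : ℝ) + 1) ^ 2 * (k + 3 + 6 * (B - 1) + 3 * (B - 1) ^ 2) ≤
            (k + 1) ^ 2 * (k + 2 * n - 3 * B) :=
          mul_le_mul_of_nonneg_left (by linarith) (by positivity)
        linarith
      calc _ ≤ 2 / (((k : ℝ) + 1) * (k + 2)) * ((k + 1) / (k + 3)) :=
            mul_le_mul ih (hr.trans hr2) (norm_nonneg _) (by positivity)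
        _ = _ := by push_cast; field_simp; ring
  have hsum : Summable fun k : ℕ => 2 / (((k : ℝ) + 1) * (k + 2)) := by
    have h := ((summable_nat_add_iff 1).2
      (Real.summable_one_div_nat_pow.2 one_lt_two)).mul_left (2 : ℝ)
    refine Summable.of_nonneg_of_le (fun k => by positivity) (fun k => ?_) h
    rw [← mul_div_assoc, mul_one]
    push_cast
    gcongr
    nlinarith [(k.cast_nonneg : (0 : ℝ) ≤ k)]
  have hlim := tendsto_tsum_of_dominated_convergence (𝓕 := atTop)
    (f := fun n k => HypParams.term ⟨a + 2 * (n : ℕ), b, c, u + 2 * n, v + 2 * n⟩ k)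
    (g := fun k => if k = 0 then 1 else 0) hsum ?_ (hlarge.mono hbound)
  · simpa using hlim
  · rintro (_ | k)
    · simp [term_zero]
    · simp only [Nat.add_eq_zero_iff, one_ne_zero, and_false, if_false]
      have hden : Tendsto (fun n : ℕ => ((k : ℝ) + 2 * n - 3 * B) * (k + 1)) atTop atTop := by
        refine Tendsto.atTop_mul_const (by positivity) ?_
        have := tendsto_atTop_add_const_left atTop ((k : ℝ) - 3 * B)
          (tendsto_natCast_atTop_atTop.const_mul_atTop (two_pos : (0 : ℝ) < 2))
        refine this.congr fun n => by ring
      have hz : Tendsto (fun n : ℕ => 2 / (((k : ℝ) + 1) * (k + 2)) *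
          (((k : ℝ) + B) ^ 2 / ((k + 2 * n - 3 * B) * (k + 1)))) atTop (𝓝 0) := by
        simpa using (tendsto_const_nhds.div_atTop hden).const_mul (2 / (((k : ℝ) + 1) * (k + 2)))
      refine squeeze_zero_norm' ?_ hz
      filter_upwards [hlarge] with n hn
      rw [term_succ, norm_mul]
      exact mul_le_mul (hbound n hn k) (norm_ratio_le ha hb hc hu hv k n rfl (hK3.trans hn))
        (norm_nonneg _) (by positivity)

/-- Quotients of products of Pochhammer symbols with equal sums of parameters. -/
lemma tendsto_prod_poch_div {m : ℕ} (x u : Fin m → ℂ) (hu : ∀ i, ¬ IsGammaPole (u i))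
    (hxu : ∑ i, x i = ∑ i, u i) :
    Tendsto (fun n : ℕ => (∏ i, poch (x i) n) / ∏ i, poch (u i) n) atTop
      (𝓝 ((∏ i, (Gamma (x i))⁻¹) * ∏ i, Gamma (u i))) := by
  have h := (tendsto_finsetProd Finset.univ fun i _ => tendsto_poch (x i)).div
    (tendsto_finsetProd Finset.univ fun i _ => tendsto_poch (u i))
    (Finset.prod_ne_zero_iff.2 fun i _ => inv_ne_zero (gamma_ne_zero (hu i)))
  simp only [Finset.prod_inv_distrib, div_inv_eq_mul] at h ⊢
  refine h.congr' ?_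
  filter_upwards [eventually_gt_atTop 0] with n hn
  have hnC : (n : ℂ) ≠ 0 := by exact_mod_cast hn.ne'
  have hf : (n.factorial : ℂ) ≠ 0 := by exact_mod_cast n.factorial_ne_zero
  have hpow : ∀ y : Fin m → ℂ, ∏ i, (n : ℂ) ^ y i = (n : ℂ) ^ ∑ i, y i := fun y => by
    simp only [Complex.cpow_def_of_ne_zero hnC, Finset.mul_sum, Complex.exp_sum]
  simp only [Finset.prod_div_distrib, Finset.prod_mul_distrib, Finset.prod_const, hpow, hxu,
    Pi.div_apply]
  have h1 : (n : ℂ) ^ (∑ i, u i) ≠ 0 := by simp [Complex.cpow_eq_zero_iff, hnC]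
  have h2 : ∏ i, poch (u i) n ≠ 0 := Finset.prod_ne_zero_iff.2 fun i _ => poch_ne_zero (hu i) n
  field_simp

/-- A recurrence `s n = r n * s (n + 1)` determines `s 0` from `lim s = 1` and `∏ r`. -/
lemma eq_of_recurrence {s r : ℕ → ℂ} {V : ℂ} (h : ∀ n, s n = r n * s (n + 1))
    (hs : Tendsto s atTop (𝓝 1))
    (hr : Tendsto (fun n => ∏ j ∈ Finset.range n, r j) atTop (𝓝 V)) : s 0 = V := by
  have e : ∀ n, (∏ j ∈ Finset.range n, r j) * s n = s 0 := by
    intro n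
    induction n with
    | zero => simp
    | succ n ih => rw [Finset.prod_range_succ, mul_assoc, ← h, ih]
  have h2 := hr.mul hs
  simp only [e, mul_one] at h2
  exact tendsto_nhds_unique tendsto_const_nhds h2

lemma IsGammaPole.half_not {z : ℂ} (h : ¬ IsGammaPole z) :
    ¬ IsGammaPole (z / 2) ∧ ¬ IsGammaPole ((z + 1) / 2) := by
  refine ⟨fun ⟨n, hn⟩ => h ⟨2 * n, ?_⟩, fun ⟨n, hn⟩ => h ⟨2 * n + 1, ?_⟩⟩ <;> push_cast <;>
    linear_combination 2 * hn

/-- Legendre's duplication formula. -/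
lemma gamma_half_mul (z : ℂ) :
    Gamma (z / 2) * Gamma ((z + 1) / 2) = Gamma z * 2 ^ (1 - z) * √Real.pi := by
  have := Complex.Gamma_mul_Gamma_add_half (z / 2)
  rwa [show z / 2 + 1 / 2 = (z + 1) / 2 by ring, show 2 * (z / 2) = z by ring] at this

lemma poch_half (z : ℂ) (n : ℕ) :
    poch (z / 2) n * poch ((z + 1) / 2) n =
      ∏ j ∈ Finset.range n, (z + 2 * j) * (z + 2 * j + 1) / 4 := by
  rw [poch_eq_prod, poch_eq_prod, ← Finset.prod_mul_distrib]
  exact Finset.prod_congr rfl fun j _ => by ring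

lemma term_succ_left (a b e c d : ℂ) (k : ℕ) :
    HypParams.term ⟨a, b, e, c, d⟩ (k + 1) = HypParams.term ⟨a + 1, b, e, c + 1, d⟩ k *
      (a * (b + k) * (e + k) / (c * (d + k) * (k + 1))) := by
  simp only [term_eq, poch_succ_left a, poch_succ_left c, poch_succ b, poch_succ e, poch_succ d,
    Nat.factorial_succ]
  push_cast
  rw [div_mul_div_comm]
  congr 1 <;> ring

lemma term_swap (a b e c d : ℂ) :
    HypParams.term ⟨a, b, e, c, d⟩ = HypParams.term ⟨a, b, e, d, c⟩ := by
  funext k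
  simp only [term_eq, mul_comm (poch c k)]

lemma IsGammaPole.not_add_natCast {x : ℂ} (h : ¬ IsGammaPole x) (k : ℕ) :
    ¬ IsGammaPole (x + k) := fun h' => h (h'.of_add_natCast k)

lemma IsGammaPole.not_add_one {x : ℂ} (h : ¬ IsGammaPole x) : ¬ IsGammaPole (x + 1) := by
  simpa using IsGammaPole.not_add_natCast h 1

lemma IsGammaPole.not_add_two {x : ℂ} (h : ¬ IsGammaPole x) : ¬ IsGammaPole (x + 2) := by
  simpa using IsGammaPole.not_add_natCast h 2

lemma ne_zero_of_not_isGammaPole {x : ℂ} (h : ¬ IsGammaPole x) : x ≠ 0 :=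
  fun h0 => h ⟨0, by simp [h0]⟩

/-! ### Whipple's theorem -/

/-- The telescoping relation behind Whipple's theorem. The factor `c - 1 + k` stands for the lower
parameter `c - 1`, and so makes sense when that parameter is zero. -/
lemma whipple_telescope {a b c d : ℂ} (hc : ¬ IsGammaPole c) (hd : ¬ IsGammaPole d)
    (h : 2 * a = c + d - 2) (N : ℕ) :
    c * ∑ k ∈ Finset.range (N + 1), (c - 1 + k) * HypParams.term ⟨a, b, 1 - b, c, d⟩ k =
      (b + c - 1) * (c - b) *
        ∑ k ∈ Finset.range (N + 1), HypParams.term ⟨a + 1, b, 1 - b, c + 1, d⟩ k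
      - (b + N) * (1 - b + N) * HypParams.term ⟨a + 1, b, 1 - b, c + 1, d⟩ N := by
  obtain rfl : a = (c + d - 2) / 2 := by linear_combination h / 2
  induction N with
  | zero => simp [term_zero]; ring
  | succ N ih =>
    rw [Finset.sum_range_succ, mul_add, ih, Finset.sum_range_succ _ (N + 1), term_succ_left,
      term_succ]
    have h1 := ne_zero_of_not_isGammaPole hc
    have h2 := add_natCast_ne_zero (IsGammaPole.not_add_one hc) N
    have h3 := add_natCast_ne_zero hd N
    have h4 : (N : ℂ) + 1 ≠ 0 := by exact_mod_cast N.succ_ne_zero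
    push_cast
    generalize HypParams.term _ N = w
    field_simp
    ring

/-- The limit of `whipple_telescope`: the remainder is of order `k ^ 2` times a term of a series
with excess `a + 1`. -/
lemma whipple_tendsto {a b c d W : ℂ} (hc : ¬ IsGammaPole c) (hd : ¬ IsGammaPole d)
    (h : 2 * a = c + d - 2) (hT : 0 < a.re ∨ IsGammaPole b ∨ IsGammaPole (1 - b))
    (hW : HasSum (HypParams.term ⟨a + 1, b, 1 - b, c + 1, d⟩) W) :
    Tendsto (fun N => ∑ k ∈ Finset.range N,
      (c - 1 + k) * HypParams.term ⟨a, b, 1 - b, c, d⟩ k) atTop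
      (𝓝 ((b + c - 1) * (c - b) / c * W)) := by
  have hc0 := ne_zero_of_not_isGammaPole hc
  have hf : (fun k : ℕ => (b + k) * (1 - b + k)) =O[atTop] fun k : ℕ => (k : ℝ) ^ 2 := by
    simpa only [sq] using (isBigO_add_natCast b).mul (isBigO_add_natCast (1 - b))
  have hG := tendsto_mul_term (p := ⟨a + 1, b, 1 - b, c + 1, d⟩) (m := 2)
    (IsGammaPole.not_add_one hc) hd
    (hT.imp (fun ha => by
      have e : c + 1 + d - (a + 1) - b - (1 - b) = a + 1 := by linear_combination -h
      simp only [HypParams.excess, e]; simp; linarith) fun hb => Or.inr hb) hf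
  rw [← tendsto_add_atTop_iff_nat 1]
  have h1 := (((tendsto_add_atTop_iff_nat 1).2 hW.tendsto_sum_nat).const_mul
    ((b + c - 1) * (c - b))).sub hG
  have h2 := h1.const_mul c⁻¹
  rw [show (b + c - 1) * (c - b) / c * W = c⁻¹ * ((b + c - 1) * (c - b) * W - 0) by
    field_simp; ring]
  refine h2.congr fun N => ?_
  rw [← whipple_telescope hc hd h N, inv_mul_cancel_left₀ hc0]

lemma whipple_summable {a b c d : ℂ} (hc : ¬ IsGammaPole c) (hd : ¬ IsGammaPole d)
    (h : 2 * a = c + d - 1) (hT : 0 < a.re ∨ IsGammaPole b ∨ IsGammaPole (1 - b)) :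
    Summable (HypParams.term ⟨a, b, 1 - b, c, d⟩) := by
  rcases hT with ha | hb
  · refine summable_term hc hd ?_
    have e : c + d - a - b - (1 - b) = a := by linear_combination -h
    simpa only [HypParams.excess, e] using ha
  · exact HypParams.Terminates.summable (Or.inr hb)

/-- This is `whipple_tendsto` for the parameter `c + 1`, where `(c + k) / (c + 1)ₖ = c / (c)ₖ`. -/
lemma whipple_step {a b c d : ℂ} (hc : ¬ IsGammaPole c) (hd : ¬ IsGammaPole d)
    (h : 2 * a = c + d - 1) (hT : 0 < a.re ∨ IsGammaPole b ∨ IsGammaPole (1 - b)) :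
    ∑' k, HypParams.term ⟨a, b, 1 - b, c, d⟩ k =
      (b + c) * (1 - b + c) / (c * (c + 1)) *
        ∑' k, HypParams.term ⟨a + 1, b, 1 - b, c + 2, d⟩ k := by
  have hT' : 0 < (a + 1).re ∨ IsGammaPole b ∨ IsGammaPole (1 - b) :=
    hT.imp_left fun h => by simp; linarith
  have hs := (whipple_summable (IsGammaPole.not_add_two hc) hd
    (by linear_combination h : 2 * (a + 1) = c + 2 + d - 1) hT').hasSum
  rw [show c + 2 = c + 1 + 1 by ring] at hs ⊢
  have h1 := whipple_tendsto (IsGammaPole.not_add_one hc) hd (by linear_combination h) hT hs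
  have hc0 := ne_zero_of_not_isGammaPole hc
  have hc1 := ne_zero_of_not_isGammaPole (IsGammaPole.not_add_one hc)
  have e : ∀ k : ℕ, (c + 1 - 1 + k) * HypParams.term ⟨a, b, 1 - b, c + 1, d⟩ k =
      c * HypParams.term ⟨a, b, 1 - b, c, d⟩ k := by
    intro k
    have h2 := poch_succ_left c k
    rw [poch_succ] at h2
    have h3 := poch_ne_zero hc k
    have h4 := poch_ne_zero (IsGammaPole.not_add_one hc) k
    have h5 := add_natCast_ne_zero hc k
    have h6 := poch_ne_zero hd k
    have hf : (k.factorial : ℂ) ≠ 0 := by exact_mod_cast k.factorial_ne_zero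
    simp only [term_eq]
    rw [add_sub_cancel_right]
    field_simp
    linear_combination (poch a k * poch b k * poch (1 - b) k) * h2
  simp only [e, ← Finset.mul_sum] at h1
  have h2 := ((whipple_summable hc hd h hT).hasSum.tendsto_sum_nat.const_mul c)
  have h3 := tendsto_nhds_unique h2 h1
  refine mul_left_cancel₀ hc0 (h3.trans ?_)
  field_simp
  ring

/-- The sum of the series in Whipple's theorem; it is symmetric in the lower parameters `c`
and `d`, and the first upper parameter is `(c + d - 1) / 2`. -/
noncomputable def whippleValue (b c d : ℂ) : ℂ :=
  Real.pi * 2 ^ (2 - c - d) * Gamma c * Gamma d *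
    ((Gamma ((b + c) / 2))⁻¹ * (Gamma ((1 - b + c) / 2))⁻¹ *
      (Gamma ((b + d) / 2))⁻¹ * (Gamma ((1 - b + d) / 2))⁻¹)

lemma tendsto_whipple_prod (b : ℂ) {c : ℂ} (hc : ¬ IsGammaPole c) :
    Tendsto (fun n : ℕ => ∏ j ∈ Finset.range n,
      (b + (c + 2 * j)) * (1 - b + (c + 2 * j)) / ((c + 2 * j) * (c + 2 * j + 1))) atTop
      (𝓝 (Gamma c * 2 ^ (1 - c) * √Real.pi *
        ((Gamma ((b + c) / 2))⁻¹ * (Gamma ((1 - b + c) / 2))⁻¹))) := by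
  have h := tendsto_prod_poch_div ![(b + c) / 2, (1 - b + c) / 2] ![c / 2, (c + 1) / 2]
    (by
      intro i
      fin_cases i
      · exact (IsGammaPole.half_not hc).1
      · exact (IsGammaPole.half_not hc).2) (by simp; ring)
  simp only [Fin.prod_univ_two, Matrix.cons_val_zero, Matrix.cons_val_one, gamma_half_mul] at h
  rw [mul_comm]
  refine h.congr fun n => ?_
  rw [poch_half, poch_eq_prod, poch_eq_prod, ← Finset.prod_mul_distrib, ← Finset.prod_div_distrib]
  refine Finset.prod_congr rfl fun j _ => ?_
  rw [div_div_eq_mul_div]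
  congr 1
  ring

/-- Whipple's theorem: raising `c`, `d` by `2` and `a` by `2` multiplies the sum by a rational
function, and the sum tends to `1` as this is iterated. -/
theorem hasSum_whipple {a b c d : ℂ} (hc : ¬ IsGammaPole c) (hd : ¬ IsGammaPole d)
    (h : 2 * a = c + d - 1) (hT : 0 < a.re ∨ IsGammaPole b ∨ IsGammaPole (1 - b)) :
    HasSum (HypParams.term ⟨a, b, 1 - b, c, d⟩) (whippleValue b c d) := by
  have key : ∀ n : ℕ, ∑' k, HypParams.term ⟨a + 2 * n, b, 1 - b, c + 2 * n, d + 2 * n⟩ k =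
      ((b + (c + 2 * n)) * (1 - b + (c + 2 * n)) / ((c + 2 * n) * (c + 2 * n + 1)) *
      ((b + (d + 2 * n)) * (1 - b + (d + 2 * n)) / ((d + 2 * n) * (d + 2 * n + 1)))) *
      ∑' k, HypParams.term ⟨a + 2 * (n + 1 : ℕ), b, 1 - b, c + 2 * (n + 1 : ℕ),
        d + 2 * (n + 1 : ℕ)⟩ k := by
    intro n
    have hn : (0 : ℝ) ≤ n := n.cast_nonneg
    have hc' : ¬ IsGammaPole (c + 2 * n) := by
      simpa using IsGammaPole.not_add_natCast hc (2 * n)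
    have hd' : ¬ IsGammaPole (d + 2 * n) := by
      simpa using IsGammaPole.not_add_natCast hd (2 * n)
    rw [whipple_step hc' hd' (by linear_combination h)
      (hT.imp_left fun h => by simp; linarith), term_swap,
      whipple_step hd' (IsGammaPole.not_add_two hc') (by linear_combination h)
      (hT.imp_left fun h => by simp; linarith), term_swap, mul_assoc]
    push_cast
    ring_nf
  have hlim := eq_of_recurrence key (tendsto_tsum_shift a b (1 - b) c d)
    (((tendsto_whipple_prod b hc).mul (tendsto_whipple_prod b hd)).congr fun n =>
      Finset.prod_mul_distrib.symm)
  have hs := (whipple_summable hc hd h hT).hasSum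
  simp only [Nat.cast_zero, mul_zero, add_zero] at hlim
  rw [hlim] at hs
  convert hs using 1
  have hpi : (√Real.pi : ℂ) * √Real.pi = Real.pi := by
    rw [← Complex.ofReal_mul, Real.mul_self_sqrt Real.pi_pos.le]
  have h2 : (2 : ℂ) ^ (2 - c - d) = 2 ^ (1 - c) * 2 ^ (1 - d) := by
    rw [← Complex.cpow_add _ _ two_ne_zero]; congr 1; ring
  rw [whippleValue, h2, ← hpi]
  ring

/-! ### Dixon's theorem -/

/-- The telescoping relation behind Dixon's theorem. -/
lemma dixon_telescope {a b c u v : ℂ} (hu : ¬ IsGammaPole u) (hv : ¬ IsGammaPole v)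
    (hub : u = 1 + a - b) (hvc : v = 1 + a - c) (N : ℕ) :
    (2 + a - 2 * b - 2 * c) * (u * (u + 1) * v * (v + 1)) *
        ∑ k ∈ Finset.range (N + 1), HypParams.term ⟨a, b, c, u, v⟩ k =
      (1 + a - b - c) * (2 + a - b - c) * (2 + a - 2 * b) * (2 + a - 2 * c) *
        ((1 + a) * ∑ k ∈ Finset.range (N + 1), HypParams.term ⟨a + 2, b, c, u + 2, v + 2⟩ k)
      + ((-a * (1 + N) ^ 2 - a * (3 + 3 * a - 2 * b - 2 * c) * (1 + N)
          + ((2 + a - 2 * b - 2 * c) * (1 - b) * (1 - c) - a ^ 2 * (3 + 2 * a - 2 * b - 2 * c))) *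
        ((b + N) * (c + N))) * HypParams.term ⟨a + 1, b, c, u + 2, v + 2⟩ N := by
  obtain rfl : b = 1 + a - u := by rw [hub]; ring
  obtain rfl : c = 1 + a - v := by rw [hvc]; ring
  have hu2 := IsGammaPole.not_add_two hu
  have hv2 := IsGammaPole.not_add_two hv
  have e1 : ∀ k : ℕ, (1 + a) * HypParams.term ⟨a + 2, 1 + a - u, 1 + a - v, u + 2, v + 2⟩ k =
      (a + 1 + k) * HypParams.term ⟨a + 1, 1 + a - u, 1 + a - v, u + 2, v + 2⟩ k := by
    intro k
    have h2 := poch_succ_left (a + 1) k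
    rw [poch_succ, show a + 1 + 1 = a + 2 by ring] at h2
    simp only [term_eq, mul_div_assoc', ← mul_assoc]
    rw [show (1 + a) * poch (a + 2) k = (a + 1 + k) * poch (a + 1) k by linear_combination -h2]
  have e2 : ∀ k : ℕ, u * (u + 1) * v * (v + 1) *
      HypParams.term ⟨a, 1 + a - u, 1 + a - v, u, v⟩ (k + 1) =
      a * (1 + a - u + k) * (1 + a - v + k) * (u + k + 1) * (v + k + 1) / (k + 1) *
        HypParams.term ⟨a + 1, 1 + a - u, 1 + a - v, u + 2, v + 2⟩ k := by
    intro k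
    have hp : ∀ x : ℂ, poch x (k + 1) * (x + k + 1) = x * (x + 1) * poch (x + 2) k := by
      intro x
      have h1 := poch_succ x (k + 1)
      rw [poch_succ_left, poch_succ_left, show x + 1 + 1 = x + 2 by ring] at h1
      push_cast at h1
      linear_combination -h1
    have h3 := poch_ne_zero hu (k + 1)
    have h4 := poch_ne_zero hv (k + 1)
    have h5 := poch_ne_zero hu2 k
    have h6 := poch_ne_zero hv2 k
    have hf : (k.factorial : ℂ) ≠ 0 := by exact_mod_cast k.factorial_ne_zero
    have hk : (k : ℂ) + 1 ≠ 0 := by exact_mod_cast k.succ_ne_zero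
    simp only [term_eq, Nat.factorial_succ, poch_succ_left a, poch_succ (1 + a - u),
      poch_succ (1 + a - v)]
    push_cast
    have h : (poch u (k + 1) * (u + k + 1)) * (poch v (k + 1) * (v + k + 1)) =
        (u * (u + 1) * poch (u + 2) k) * (v * (v + 1) * poch (v + 2) k) := by rw [hp, hp]
    field_simp
    linear_combination (-(a * (1 + a - u + k) * (1 + a - v + k) * poch (a + 1) k *
      poch (1 + a - u) k * poch (1 + a - v) k)) * h
  simp only [Finset.mul_sum _ _ (1 + a), e1]
  induction N with
  | zero => simp [term_zero]; ring
  | succ N ih =>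
    rw [Finset.sum_range_succ, mul_add, ih, mul_assoc _ (u * (u + 1) * v * (v + 1))
      (HypParams.term ⟨a, 1 + a - u, 1 + a - v, u, v⟩ (N + 1)), e2,
      Finset.sum_range_succ _ (N + 1), term_succ]
    have h2 := add_natCast_ne_zero hu2 N
    have h3 := add_natCast_ne_zero hv2 N
    have h4 : (N : ℂ) + 1 ≠ 0 := by exact_mod_cast N.succ_ne_zero
    push_cast
    generalize HypParams.term _ N = w
    field_simp
    ring

/-- The limit of `dixon_telescope`: the remainder is of order `k ^ 4` times a term of a series with
excess larger by `3`. The factor `1 + a` belongs to the hypothesis, since for `a = -1` the series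
with the parameter `a + 2` need not converge. -/
lemma tendsto_dixon {a b c u v X : ℂ} (hu : ¬ IsGammaPole u) (hv : ¬ IsGammaPole v)
    (hub : u = 1 + a - b) (hvc : v = 1 + a - c) (hL : 2 + a - 2 * b - 2 * c ≠ 0)
    (hT : 0 < (2 + a - 2 * b - 2 * c).re ∨ IsGammaPole (a + 1) ∨ IsGammaPole b ∨ IsGammaPole c)
    (hX : Tendsto (fun N => (1 + a) *
      ∑ k ∈ Finset.range N, HypParams.term ⟨a + 2, b, c, u + 2, v + 2⟩ k) atTop (𝓝 X)) :
    Tendsto (fun N => ∑ k ∈ Finset.range N, HypParams.term ⟨a, b, c, u, v⟩ k) atTop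
      (𝓝 ((1 + a - b - c) * (2 + a - b - c) * (2 + a - 2 * b) * (2 + a - 2 * c) /
        ((2 + a - 2 * b - 2 * c) * (u * (u + 1) * v * (v + 1))) * X)) := by
  have hc0 : (2 + a - 2 * b - 2 * c) * (u * (u + 1) * v * (v + 1)) ≠ 0 := by
    have := ne_zero_of_not_isGammaPole hu
    have := ne_zero_of_not_isGammaPole (IsGammaPole.not_add_one hu)
    have := ne_zero_of_not_isGammaPole hv
    have := ne_zero_of_not_isGammaPole (IsGammaPole.not_add_one hv)
    exact mul_ne_zero hL (by simp only [ne_eq, mul_eq_zero, not_or]; tauto)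
  have hlin : ∀ x : ℂ, (fun k : ℕ => x + k) =O[atTop] fun k : ℕ => (k : ℝ) := isBigO_add_natCast
  have hconst : ∀ x : ℂ, (fun _ : ℕ => x) =O[atTop] fun k : ℕ => (k : ℝ) ^ 2 := fun x => by
    refine IsBigO.of_bound ‖x‖ ?_
    filter_upwards [eventually_ge_atTop 1] with k hk
    have : (1 : ℝ) ≤ k ^ 2 := one_le_pow₀ (by exact_mod_cast hk)
    simpa using le_mul_of_one_le_right (norm_nonneg x) this
  have hle : (fun k : ℕ => (k : ℝ)) =O[atTop] fun k : ℕ => (k : ℝ) ^ 2 := by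
    refine IsBigO.of_bound 1 ?_
    filter_upwards [eventually_ge_atTop 1] with k hk
    have : (1 : ℝ) ≤ k := by exact_mod_cast hk
    simp
    nlinarith
  have hf := (((((hlin 1).pow 2).const_mul_left (-a)).sub
    (((hlin 1).trans hle).const_mul_left (a * (3 + 3 * a - 2 * b - 2 * c)))).add
    (hconst ((2 + a - 2 * b - 2 * c) * (1 - b) * (1 - c) -
      a ^ 2 * (3 + 2 * a - 2 * b - 2 * c)))).mul ((hlin b).mul (hlin c))
  have hG := tendsto_mul_term (p := ⟨a + 1, b, c, u + 2, v + 2⟩) (m := 4)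
    (IsGammaPole.not_add_two hu) (IsGammaPole.not_add_two hv)
    (hT.imp (fun ha => by
      have e : u + 2 + (v + 2) - (a + 1) - b - c = (2 + a - 2 * b - 2 * c) + 3 := by
        rw [hub, hvc]; ring
      simp only [HypParams.excess, e]; rw [Complex.add_re]; simp; simp at ha; linarith) id)
    (hf.congr_right fun k => by ring)
  rw [← tendsto_add_atTop_iff_nat 1]
  have h1 := (((tendsto_add_atTop_iff_nat 1).2 hX).const_mul
    ((1 + a - b - c) * (2 + a - b - c) * (2 + a - 2 * b) * (2 + a - 2 * c))).add hG
  have h2 := h1.const_mul ((2 + a - 2 * b - 2 * c) * (u * (u + 1) * v * (v + 1)))⁻¹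
  rw [add_zero, inv_mul_eq_div, mul_div_right_comm] at h2
  refine h2.congr fun N => ?_
  rw [← dixon_telescope hu hv hub hvc N, inv_mul_cancel_left₀ hc0]

/-- The sum of the series in Dixon's theorem. -/
noncomputable def dixonValue (a b c : ℂ) : ℂ :=
  √Real.pi * 2 ^ (-a) * Gamma (1 + a - b) * Gamma (1 + a - c) * Gamma (1 + a / 2 - b - c) *
    ((Gamma ((1 + a) / 2))⁻¹ * (Gamma (1 + a - b - c))⁻¹ * (Gamma (1 + a / 2 - b))⁻¹ *
      (Gamma (1 + a / 2 - c))⁻¹)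

/-- The functional equation of `1 / Γ`, which holds at the poles of `Γ` too. -/
lemma inv_gamma_eq (z : ℂ) : (Gamma z)⁻¹ = z * (Gamma (z + 1))⁻¹ := by
  simpa using Complex.one_div_Gamma_eq_self_mul_one_div_Gamma_add_one z

lemma gamma_add_two {z : ℂ} (hz : ¬ IsGammaPole z) :
    Gamma (z + 2) = (z + 1) * z * Gamma z := by
  rw [show z + 2 = z + 1 + 1 by ring,
    Complex.Gamma_add_one _ (ne_zero_of_not_isGammaPole (IsGammaPole.not_add_one hz)),
    Complex.Gamma_add_one _ (ne_zero_of_not_isGammaPole hz), mul_assoc]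

lemma dixonValue_eq {a b c : ℂ} (hu : ¬ IsGammaPole (1 + a - b)) (hv : ¬ IsGammaPole (1 + a - c))
    (hL : 2 + a - 2 * b - 2 * c ≠ 0) :
    dixonValue a b c = (1 + a - b - c) * (2 + a - b - c) * (2 + a - 2 * b) * (2 + a - 2 * c) /
        ((2 + a - 2 * b - 2 * c) * ((1 + a - b) * (1 + a - b + 1) * (1 + a - c) * (1 + a - c + 1)))
        * ((1 + a) * dixonValue (a + 2) b c) := by
  have hL' : 1 + a / 2 - b - c ≠ 0 := fun h => hL (by linear_combination 2 * h)
  have h1 := ne_zero_of_not_isGammaPole hu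
  have h2 := ne_zero_of_not_isGammaPole (IsGammaPole.not_add_one hu)
  have h3 := ne_zero_of_not_isGammaPole hv
  have h4 := ne_zero_of_not_isGammaPole (IsGammaPole.not_add_one hv)
  have hpow : (2 : ℂ) ^ (-(a + 2)) = 2 ^ (-a) / 4 := by
    rw [neg_add', Complex.cpow_sub _ _ two_ne_zero]
    norm_num
  simp only [dixonValue]
  rw [inv_gamma_eq ((1 + a) / 2), inv_gamma_eq (1 + a - b - c), inv_gamma_eq (1 + a - b - c + 1),
    inv_gamma_eq (1 + a / 2 - b), inv_gamma_eq (1 + a / 2 - c), hpow,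
    show 1 + (a + 2) - b = 1 + a - b + 2 by ring, show 1 + (a + 2) - c = 1 + a - c + 2 by ring,
    show 1 + (a + 2) / 2 - b - c = 1 + a / 2 - b - c + 1 by ring,
    show (1 + (a + 2)) / 2 = (1 + a) / 2 + 1 by ring,
    show 1 + a - b + 2 - c = 1 + a - b - c + 1 + 1 by ring,
    show 1 + (a + 2) / 2 - b = 1 + a / 2 - b + 1 by ring,
    show 1 + (a + 2) / 2 - c = 1 + a / 2 - c + 1 by ring,
    gamma_add_two hu, gamma_add_two hv, Complex.Gamma_add_one _ hL']
  rw [show 2 + a - 2 * b - 2 * c = 2 * (1 + a / 2 - b - c) by ring]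
  have hL2 : 2 * (1 + a / 2 - b - c) ≠ 0 := mul_ne_zero two_ne_zero hL'
  have hden : 2 * (1 + a / 2 - b - c) *
      ((1 + a - b) * (1 + a - b + 1) * (1 + a - c) * (1 + a - c + 1)) ≠ 0 :=
    mul_ne_zero hL2 (by simp only [ne_eq, mul_eq_zero, not_or]; tauto)
  refine ((eq_div_iff hden).2 ?_).trans (div_mul_eq_mul_div _ _ _).symm
  ring

lemma dixon_summable {a b c u v : ℂ} (hu : ¬ IsGammaPole u) (hv : ¬ IsGammaPole v)
    (hub : u = 1 + a - b) (hvc : v = 1 + a - c)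
    (hT : 0 < (2 + a - 2 * b - 2 * c).re ∨ IsGammaPole a ∨ IsGammaPole b ∨ IsGammaPole c) :
    Summable (HypParams.term ⟨a, b, c, u, v⟩) := by
  rcases hT with ha | hb
  · refine summable_term hu hv ?_
    have e : u + v - a - b - c = 2 + a - 2 * b - 2 * c := by rw [hub, hvc]; ring
    simpa only [HypParams.excess, e] using ha
  · exact HypParams.Terminates.summable hb

lemma dixon_step {a b c u v : ℂ} (hu : ¬ IsGammaPole u) (hv : ¬ IsGammaPole v)
    (hub : u = 1 + a - b) (hvc : v = 1 + a - c) (hL : 2 + a - 2 * b - 2 * c ≠ 0)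
    (hT : 0 < (2 + a - 2 * b - 2 * c).re ∨ IsGammaPole b ∨ IsGammaPole c) :
    ∑' k, HypParams.term ⟨a, b, c, u, v⟩ k =
      (1 + a - b - c) * (2 + a - b - c) * (2 + a - 2 * b) * (2 + a - 2 * c) /
        ((2 + a - 2 * b - 2 * c) * (u * (u + 1) * v * (v + 1))) * (1 + a) *
        ∑' k, HypParams.term ⟨a + 2, b, c, u + 2, v + 2⟩ k := by
  have hT2 : 0 < (2 + (a + 2) - 2 * b - 2 * c).re ∨ IsGammaPole b ∨ IsGammaPole c :=
    hT.imp_left fun h => by simp at h ⊢; linarith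
  have hs := (dixon_summable (a := a + 2) (b := b) (c := c) (IsGammaPole.not_add_two hu)
    (IsGammaPole.not_add_two hv) (by rw [hub]; ring) (by rw [hvc]; ring)
    (hT2.imp_right Or.inr)).hasSum
  have h1 := tendsto_dixon hu hv hub hvc hL (hT.imp_right Or.inr)
    (hs.tendsto_sum_nat.const_mul _)
  rw [mul_assoc]
  exact tendsto_nhds_unique
    (dixon_summable hu hv hub hvc (hT.imp_right Or.inr)).hasSum.tendsto_sum_nat h1

lemma tendsto_dixon_prod {a b c : ℂ} (hu : ¬ IsGammaPole (1 + a - b))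
    (hv : ¬ IsGammaPole (1 + a - c)) (hL : ¬ IsGammaPole (1 + a / 2 - b - c)) :
    Tendsto (fun n : ℕ => ∏ j ∈ Finset.range n,
      ((1 + (a + 2 * j) - b - c) * (2 + (a + 2 * j) - b - c) * (2 + (a + 2 * j) - 2 * b) *
        (2 + (a + 2 * j) - 2 * c) /
        ((2 + (a + 2 * j) - 2 * b - 2 * c) * ((1 + (a + 2 * j) - b) * (1 + (a + 2 * j) - b + 1) *
          (1 + (a + 2 * j) - c) * (1 + (a + 2 * j) - c + 1))) * (1 + (a + 2 * j)))) atTop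
      (𝓝 (dixonValue a b c)) := by
  have h := tendsto_prod_poch_div
    ![(1 + a) / 2, (1 + a - b - c) / 2, (1 + a - b - c + 1) / 2, 1 + a / 2 - b, 1 + a / 2 - c]
    ![1 + a / 2 - b - c, (1 + a - b) / 2, (1 + a - b + 1) / 2, (1 + a - c) / 2, (1 + a - c + 1) / 2]
    (by
      intro i
      fin_cases i
      · exact hL
      · exact (IsGammaPole.half_not hu).1
      · exact (IsGammaPole.half_not hu).2
      · exact (IsGammaPole.half_not hv).1
      · exact (IsGammaPole.half_not hv).2) (by simp [Fin.sum_univ_succ]; ring)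
  simp only [Fin.prod_univ_five, Matrix.cons_val] at h
  have e : ∀ x y z w t : ℂ, x * y * z * w * t = x * (y * z) * w * t := by intros; ring
  have e' : ∀ x y z w t : ℂ, x * y * z * w * t = x * (y * z) * (w * t) := by intros; ring
  have hval : dixonValue a b c = (Gamma ((1 + a) / 2))⁻¹ * (Gamma ((1 + a - b - c) / 2))⁻¹ *
      (Gamma ((1 + a - b - c + 1) / 2))⁻¹ * (Gamma (1 + a / 2 - b))⁻¹ * (Gamma (1 + a / 2 - c))⁻¹ *
      (Gamma (1 + a / 2 - b - c) * Gamma ((1 + a - b) / 2) * Gamma ((1 + a - b + 1) / 2) *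
        Gamma ((1 + a - c) / 2) * Gamma ((1 + a - c + 1) / 2)) := by
    rw [e (Gamma ((1 + a) / 2))⁻¹, ← mul_inv, gamma_half_mul, e' (Gamma (1 + a / 2 - b - c)),
      gamma_half_mul, gamma_half_mul, dixonValue]
    have hpi : (√Real.pi : ℂ) ≠ 0 := by
      exact_mod_cast (Real.sqrt_pos.2 Real.pi_pos).ne'
    have h2 : (2 : ℂ) ^ (1 - (1 + a - b)) * 2 ^ (1 - (1 + a - c)) =
        2 ^ (1 - (1 + a - b - c)) * 2 ^ (-a) := by
      rw [← Complex.cpow_add _ _ two_ne_zero, ← Complex.cpow_add _ _ two_ne_zero]; congr 1; ring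
    have h3 : (2 : ℂ) ^ (1 - (1 + a - b - c)) ≠ 0 := by simp [Complex.cpow_eq_zero_iff]
    have h4 : ((√Real.pi : ℂ))⁻¹ * (√Real.pi : ℂ) = 1 := inv_mul_cancel₀ hpi
    have h5 : ((2 : ℂ) ^ (1 - (1 + a - b - c)))⁻¹ * (2 ^ (1 - (1 + a - b)) * 2 ^ (1 - (1 + a - c)))
        = 2 ^ (-a) := by rw [h2, inv_mul_cancel_left₀ h3]
    rw [← h5]
    simp only [mul_inv]
    linear_combination (-(√Real.pi : ℂ) * ((2 : ℂ) ^ (1 - (1 + a - b - c)))⁻¹ *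
      (2 ^ (1 - (1 + a - b)) * 2 ^ (1 - (1 + a - c))) * Gamma (1 + a - b) * Gamma (1 + a - c) *
      Gamma (1 + a / 2 - b - c) * ((Gamma ((1 + a) / 2))⁻¹ * (Gamma (1 + a - b - c))⁻¹ *
      (Gamma (1 + a / 2 - b))⁻¹ * (Gamma (1 + a / 2 - c))⁻¹)) * h4
  rw [hval]
  refine h.congr fun n => ?_
  rw [e (poch _ n), poch_half, e' (poch _ n), poch_half, poch_half]
  simp only [poch_eq_prod, ← Finset.prod_mul_distrib, ← Finset.prod_div_distrib]
  refine Finset.prod_congr rfl fun j _ => ?_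
  -- The factors `2` that clear the denominators of the halved parameters multiply to `32`.
  have hp : ∀ x y : ℂ, x * 32 / (y * 32) = x / y := fun x y =>
    mul_div_mul_right x y (by norm_num)
  rw [← hp, mul_comm_div, mul_comm, ← mul_div_assoc]
  ring

/-- Dixon's theorem: raising `a` by `2` multiplies the sum by a rational function, and the sum
tends to `1` as this is iterated. If `a` is a non-positive integer, the series need not converge
for large `a`, but the iteration ends at `a = 0` or `a = -1`. -/
theorem hasSum_dixon {a b c u v : ℂ} (hu : ¬ IsGammaPole u) (hv : ¬ IsGammaPole v)
    (hub : u = 1 + a - b) (hvc : v = 1 + a - c) (hL : ¬ IsGammaPole (1 + a / 2 - b - c))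
    (hT : 0 < (2 + a - 2 * b - 2 * c).re ∨ IsGammaPole a ∨ IsGammaPole b ∨ IsGammaPole c) :
    HasSum (HypParams.term ⟨a, b, c, u, v⟩) (dixonValue a b c) := by
  have hL0 : ∀ {a : ℂ}, ¬ IsGammaPole (1 + a / 2 - b - c) → 2 + a - 2 * b - 2 * c ≠ 0 :=
    fun h h0 => ne_zero_of_not_isGammaPole h (by linear_combination h0 / 2)
  have hmain : ∀ n : ℕ, ∀ a u v : ℂ, ¬ IsGammaPole u → ¬ IsGammaPole v → u = 1 + a - b →
      v = 1 + a - c → ¬ IsGammaPole (1 + a / 2 - b - c) → a = -(n : ℂ) →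
      HasSum (HypParams.term ⟨a, b, c, u, v⟩) (dixonValue a b c) := by
    intro n
    induction n using Nat.twoStepInduction with
    | zero =>
      rintro a u v hu hv rfl rfl hL ha
      obtain rfl : a = 0 := by simpa using ha
      have hval : dixonValue 0 b c = 1 := by
        have h1 := gamma_ne_zero hu
        have h2 := gamma_ne_zero hv
        have h3 := gamma_ne_zero hL
        have h4 : (√Real.pi : ℂ) ≠ 0 := by
          exact_mod_cast (Real.sqrt_pos.2 Real.pi_pos).ne'
        have h5 : Gamma (1 / 2) = (√Real.pi : ℂ) := by
          rw [Complex.Gamma_one_half_eq, Real.sqrt_eq_rpow, Complex.ofReal_cpow Real.pi_pos.le]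
          norm_num
        simp only [dixonValue, zero_div, add_zero, neg_zero, Complex.cpow_zero, h5] at *
        field_simp
      rw [hval]
      convert hasSum_ite_eq 0 (1 : ℂ) using 2 with k
      rcases k with _ | k
      · simp [term_zero]
      · simp [term_eq, poch_succ_left]
    | one =>
      rintro a u v hu hv hub hvc hL ha
      -- The factor `1 + a` vanishes, and so does the sum.
      have ha1 : 1 + a = 0 := by rw [ha]; simp
      refine hasSum_of_tendsto_sum_range
        (dixon_summable hu hv hub hvc (Or.inr (Or.inl ⟨1, ha⟩))) ?_
      have h := tendsto_dixon (X := (1 + a) * dixonValue (a + 2) b c) hu hv hub hvc (hL0 hL)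
        (Or.inr (Or.inl ⟨0, by linear_combination ha1⟩))
        (by simp only [ha1, zero_mul]; exact tendsto_const_nhds)
      subst hub hvc
      rwa [← dixonValue_eq hu hv (hL0 hL)] at h
    | more n ih _ =>
      rintro a u v hu hv hub hvc hL ha
      refine hasSum_of_tendsto_sum_range
        (dixon_summable hu hv hub hvc (Or.inr (Or.inl ⟨n + 2, ha⟩))) ?_
      have h := tendsto_dixon (X := (1 + a) * dixonValue (a + 2) b c) hu hv hub hvc (hL0 hL)
        (Or.inr (Or.inl ⟨n + 1, by rw [ha]; push_cast; ring⟩))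
        ((ih (a + 2) (u + 2) (v + 2) (IsGammaPole.not_add_two hu) (IsGammaPole.not_add_two hv)
          (by rw [hub]; ring) (by rw [hvc]; ring)
          (by
            rw [show 1 + (a + 2) / 2 - b - c = 1 + a / 2 - b - c + 1 by ring]
            exact IsGammaPole.not_add_one hL)
          (by rw [ha]; push_cast; ring)).tendsto_sum_nat.const_mul _)
      subst hub hvc
      rwa [← dixonValue_eq hu hv (hL0 hL)] at h
  by_cases ha : IsGammaPole a
  · obtain ⟨n, hn⟩ := ha
    exact hmain n a u v hu hv hub hvc hL hn
  have hT' : 0 < (2 + a - 2 * b - 2 * c).re ∨ IsGammaPole b ∨ IsGammaPole c := by tauto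
  subst hub hvc
  have key : ∀ n : ℕ, ∑' k, HypParams.term
        ⟨a + 2 * n, b, c, 1 + (a + 2 * n) - b, 1 + (a + 2 * n) - c⟩ k =
      ((1 + (a + 2 * n) - b - c) * (2 + (a + 2 * n) - b - c) * (2 + (a + 2 * n) - 2 * b) *
        (2 + (a + 2 * n) - 2 * c) /
        ((2 + (a + 2 * n) - 2 * b - 2 * c) * ((1 + (a + 2 * n) - b) * (1 + (a + 2 * n) - b + 1) *
          (1 + (a + 2 * n) - c) * (1 + (a + 2 * n) - c + 1))) * (1 + (a + 2 * n))) *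
      ∑' k, HypParams.term ⟨a + 2 * (n + 1 : ℕ), b, c, 1 + (a + 2 * (n + 1 : ℕ)) - b,
        1 + (a + 2 * (n + 1 : ℕ)) - c⟩ k := by
    intro n
    rw [show a + 2 * ((n + 1 : ℕ) : ℂ) = a + 2 * n + 2 by push_cast; ring,
      show 1 + (a + 2 * n + 2) - b = 1 + (a + 2 * n) - b + 2 by ring,
      show 1 + (a + 2 * n + 2) - c = 1 + (a + 2 * n) - c + 2 by ring]
    refine dixon_step (a := a + 2 * n) ?_ ?_ rfl rfl (hL0 ?_) (hT'.imp_left fun h => ?_)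
    · rw [show 1 + (a + 2 * n) - b = 1 + a - b + (2 * n : ℕ) by push_cast; ring]
      exact IsGammaPole.not_add_natCast hu (2 * n)
    · rw [show 1 + (a + 2 * n) - c = 1 + a - c + (2 * n : ℕ) by push_cast; ring]
      exact IsGammaPole.not_add_natCast hv (2 * n)
    · rw [show 1 + (a + 2 * n) / 2 - b - c = 1 + a / 2 - b - c + n by ring]
      exact IsGammaPole.not_add_natCast hL n
    · have hn : (0 : ℝ) ≤ n := n.cast_nonneg
      simp at h ⊢
      linarith
  have hlim := eq_of_recurrence key ((tendsto_tsum_shift a b c (1 + a - b) (1 + a - c)).congr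
    fun n => by rw [sub_add_eq_add_sub, sub_add_eq_add_sub, add_assoc 1 a])
    (tendsto_dixon_prod hu hv hL)
  have hs := (dixon_summable hu hv rfl rfl hT).hasSum
  simp only [Nat.cast_zero, mul_zero, add_zero] at hlim
  rwa [hlim] at hs

/-! ### The series contiguous to Dixon's theorem -/

lemma IsGammaPole.add_one {x : ℂ} (h : IsGammaPole x) (h0 : x ≠ 0) : IsGammaPole (x + 1) := by
  obtain ⟨n, rfl⟩ := h
  rcases n with _ | n
  · simp at h0
  · exact ⟨n, by push_cast; ring⟩

/-- Legendre's duplication formula, solved for the quotient of two gamma functions. -/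
lemma gamma_half_div {z : ℂ} (h₁ : ¬ IsGammaPole (z / 2)) (h₂ : ¬ IsGammaPole ((z + 1) / 2)) :
    Gamma (z / 2) * (Gamma z)⁻¹ = 2 ^ (1 - z) * √Real.pi * (Gamma ((z + 1) / 2))⁻¹ ∧
    Gamma ((z + 1) / 2) * (Gamma z)⁻¹ = 2 ^ (1 - z) * √Real.pi * (Gamma (z / 2))⁻¹ := by
  have h := gamma_half_mul z
  have g₁ := gamma_ne_zero h₁
  have g₂ := gamma_ne_zero h₂
  have g : Gamma z ≠ 0 := fun h0 => mul_ne_zero g₁ g₂ (by rw [h, h0]; ring)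
  constructor
  · field_simp
    linear_combination h
  · field_simp
    linear_combination h

lemma two_cpow_mul {x y z : ℂ} (h : x + y = z) : (2 : ℂ) ^ x * 2 ^ y = 2 ^ z := by
  rw [← Complex.cpow_add _ _ two_ne_zero, h]

lemma sqrt_pi_mul_self : (√Real.pi : ℂ) * √Real.pi = Real.pi := by
  rw [← Complex.ofReal_mul, Real.mul_self_sqrt Real.pi_pos.le]

/-- The telescoping relation that expresses the series `X_{0,1}` by two of Dixon's series. -/
lemma dixonContiguous_telescope {a b c : ℂ} (hu : ¬ IsGammaPole (1 + b - c))
    (hv : ¬ IsGammaPole (b + 2 - a)) (N : ℕ) :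
    2 * (a - 1) * ((a - 1) *
        ∑ k ∈ Finset.range N, HypParams.term ⟨a, b, c, b + 2 - a, 1 + b - c⟩ k) =
      -(a - 1) * (2 + b - 2 * a) *
        ∑ k ∈ Finset.range N, HypParams.term ⟨b, c, a - 1, 1 + b - c, b + 2 - a⟩ k
      + (1 + b - 2 * c) * (a - 1) / (1 + b - c) * (b *
        ∑ k ∈ Finset.range N, HypParams.term ⟨b + 1, c, a, 1 + b - c + 1, b + 2 - a⟩ k)
      + N * (1 + b - a + N) * HypParams.term ⟨b, c, a - 1, 1 + b - c, b + 2 - a⟩ N := by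
  have hp : ∀ (x : ℂ) (k : ℕ), x * poch (x + 1) k = poch x k * (x + k) := fun x k => by
    rw [← poch_succ, poch_succ_left]
  have e1 : ∀ k : ℕ, (a - 1) * HypParams.term ⟨a, b, c, b + 2 - a, 1 + b - c⟩ k =
      (a - 1 + k) * HypParams.term ⟨b, c, a - 1, 1 + b - c, b + 2 - a⟩ k := by
    intro k
    have h := hp (a - 1) k
    rw [sub_add_cancel] at h
    simp only [term_eq, mul_div_assoc']
    rw [mul_comm (poch (b + 2 - a) k)]
    congr 1
    linear_combination (poch b k * poch c k) * h
  have e2 : ∀ k : ℕ, (a - 1) / (1 + b - c) *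
      (b * HypParams.term ⟨b + 1, c, a, 1 + b - c + 1, b + 2 - a⟩ k) =
      (b + k) * (a - 1 + k) / (1 + b - c + k) *
        HypParams.term ⟨b, c, a - 1, 1 + b - c, b + 2 - a⟩ k := by
    intro k
    have h := hp (a - 1) k
    rw [sub_add_cancel] at h
    have h' := hp b k
    have h'' := hp (1 + b - c) k
    have h1 := ne_zero_of_not_isGammaPole hu
    have h2 := add_natCast_ne_zero hu k
    have h3 := poch_ne_zero hu k
    have h4 := poch_ne_zero (IsGammaPole.not_add_one hu) k
    have h5 := poch_ne_zero hv k
    have hf : (k.factorial : ℂ) ≠ 0 := by exact_mod_cast k.factorial_ne_zero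
    have hq : ((a - 1) * poch a k) * (b * poch (b + 1) k) * (poch (1 + b - c) k * (1 + b - c + k)) =
        (poch (a - 1) k * (a - 1 + k)) * (poch b k * (b + k)) *
          ((1 + b - c) * poch (1 + b - c + 1) k) := by rw [h, h', h'']
    simp only [term_eq]
    generalize poch (1 + b - c) k = p1 at *
    generalize poch (1 + b - c + 1) k = p2 at *
    generalize poch (b + 2 - a) k = p3 at *
    generalize 1 + b - c = u at *
    field_simp
    linear_combination (poch c k) * hq
  simp only [Finset.mul_sum _ _ (a - 1), e1]
  rw [mul_div_assoc, mul_assoc (1 + b - 2 * c), Finset.mul_sum _ _ b,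
    Finset.mul_sum _ _ ((a - 1) / (1 + b - c)), Finset.sum_congr rfl fun k _ => e2 k]
  induction N with
  | zero => simp
  | succ N ih =>
    have h1 := add_natCast_ne_zero hu N
    have h2 := add_natCast_ne_zero hv N
    have h3 : (N : ℂ) + 1 ≠ 0 := by exact_mod_cast N.succ_ne_zero
    have key : ∀ w : ℂ, 2 * (a - 1) * ((a - 1 + N) * w) = -(a - 1) * (2 + b - 2 * a) * w +
        (1 + b - 2 * c) * ((b + N) * (a - 1 + N) / (1 + b - c + N) * w) +
        (N + 1) * (1 + b - a + (N + 1)) * (w * ((b + N) * (c + N) * (a - 1 + N) /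
          ((1 + b - c + N) * (b + 2 - a + N) * (N + 1)))) - N * (1 + b - a + N) * w := by
      intro w
      rw [show 1 + b - a + ((N : ℂ) + 1) = b + 2 - a + N by ring]
      field_simp
      ring
    simp only [Finset.sum_range_succ]
    rw [term_succ]
    push_cast
    linear_combination ih + key (HypParams.term ⟨b, c, a - 1, 1 + b - c, b + 2 - a⟩ N)

/-- The series `X_{0,1}(b, c, a)`, a combination of the Dixon series with the parameters
`(b, c, a - 1)` and `(b + 1, c, a)`. -/
lemma hasSum_dixonContiguous {a b c : ℂ} (hv : ¬ IsGammaPole (b + 2 - a))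
    (hu : ¬ IsGammaPole (1 + b - c)) (h₁ : ¬ IsGammaPole (b / 2 - c - a + 2))
    (h₂ : ¬ IsGammaPole (b / 2 - c - a + 3 / 2)) (ha : a ≠ 1)
    (hT : 0 < (3 + b - 2 * a - 2 * c).re ∨ IsGammaPole a ∨ IsGammaPole b ∨ IsGammaPole c) :
    HasSum (HypParams.term ⟨a, b, c, b + 2 - a, 1 + b - c⟩)
      (-(Gamma (b + 2 - a) * Gamma (1 + b - c) * Gamma (b / 2 - c - a + 2) * (√Real.pi : ℂ) /
            (Gamma (-a + 1 + b / 2) * Gamma (b / 2 - c + 1) * Gamma (b / 2 + 1 / 2) * (a - 1) *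
              Gamma (-c - a + b + 2) * 2 ^ b))
          + Gamma (b + 2 - a) * Gamma (1 + b - c) * Gamma (b / 2 - c - a + 3 / 2) *
              (√Real.pi : ℂ) /
            ((a - 1) * Gamma (-c - a + b + 2) * Gamma (b / 2) * Gamma (b / 2 + 3 / 2 - a) * 2 ^ b *
              Gamma (1 / 2 + b / 2 - c))) := by
  have ha1 : a - 1 ≠ 0 := sub_ne_zero.2 ha
  have hu0 := ne_zero_of_not_isGammaPole hu
  have hpole : ∀ {x : ℂ}, IsGammaPole x → IsGammaPole (x - 1) := fun ⟨n, hn⟩ =>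
    ⟨n + 1, by rw [hn]; push_cast; ring⟩
  have hs : Summable (HypParams.term ⟨a, b, c, b + 2 - a, 1 + b - c⟩) := by
    rcases hT with h | h
    · refine summable_term hv hu ?_
      have e : b + 2 - a + (1 + b - c) - a - b - c = 3 + b - 2 * a - 2 * c := by ring
      simpa only [HypParams.excess, e] using h
    · exact HypParams.Terminates.summable h
  have hV1 : HasSum (HypParams.term ⟨b, c, a - 1, 1 + b - c, b + 2 - a⟩)
      (dixonValue b c (a - 1)) := by
    refine hasSum_dixon hu hv rfl (by ring) ?_ ?_
    · rwa [show 1 + b / 2 - c - (a - 1) = b / 2 - c - a + 2 by ring]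
    · rcases hT with h | h | h | h
      · left
        simp at h ⊢
        linarith
      · exact Or.inr (Or.inr (Or.inr (hpole h)))
      · exact Or.inr (Or.inl h)
      · exact Or.inr (Or.inr (Or.inl h))
  -- For `b = 0` this series need not converge, but it occurs with the factor `b`.
  have hV2 : Tendsto (fun N => b * ∑ k ∈ Finset.range N,
      HypParams.term ⟨b + 1, c, a, 1 + b - c + 1, b + 2 - a⟩ k) atTop
      (𝓝 (b * dixonValue (b + 1) c a)) := by
    rcases eq_or_ne b 0 with hb | hb
    · simp [hb]
    · refine (HasSum.tendsto_sum_nat ?_).const_mul b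
      refine hasSum_dixon (IsGammaPole.not_add_one hu) hv (by ring) (by ring) ?_ ?_
      · rwa [show 1 + (b + 1) / 2 - c - a = b / 2 - c - a + 3 / 2 by ring]
      · rcases hT with h | h | h | h
        · left
          simp at h ⊢
          linarith
        · exact Or.inr (Or.inr (Or.inr h))
        · exact Or.inr (Or.inl (h.add_one hb))
        · exact Or.inr (Or.inr (Or.inl h))
  have hf : (fun N : ℕ => (N : ℂ) * (1 + b - a + N)) =O[atTop] fun N : ℕ => (N : ℝ) ^ 2 := by
    simpa [sq] using (isBigO_add_natCast 0).mul (isBigO_add_natCast (1 + b - a))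
  have hG := tendsto_mul_term (p := ⟨b, c, a - 1, 1 + b - c, b + 2 - a⟩) (m := 2) hu hv (by
    rcases hT with h | h | h | h
    · left
      have e : 1 + b - c + (b + 2 - a) - b - c - (a - 1) = 3 + b - 2 * a - 2 * c + 1 := by ring
      simp only [HypParams.excess, e]
      rw [Complex.add_re]
      push_cast
      simp only [Complex.one_re]
      linarith
    · exact Or.inr (Or.inr (Or.inr (hpole h)))
    · exact Or.inr (Or.inl h)
    · exact Or.inr (Or.inr (Or.inl h))) hf
  refine hasSum_of_tendsto_sum_range hs ?_
  have h := ((hV1.tendsto_sum_nat.const_mul (-(a - 1) * (2 + b - 2 * a))).add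
    (hV2.const_mul ((1 + b - 2 * c) * (a - 1) / (1 + b - c)))).add hG
  simp only [← dixonContiguous_telescope hu hv, ← mul_assoc (2 * (a - 1))] at h
  have hden : 2 * (a - 1) * (a - 1) ≠ 0 := mul_ne_zero (mul_ne_zero two_ne_zero ha1) ha1
  have h' := h.const_mul (2 * (a - 1) * (a - 1))⁻¹
  simp only [inv_mul_cancel_left₀ hden] at h'
  convert h' using 2
  rw [eq_inv_mul_iff_mul_eq₀ hden]
  have e : ∀ A x₁ x₂ x₃ x₄ x₅ x₆ : ℂ, A / (x₁ * x₂ * x₃ * x₄ * x₅ * x₆) =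
      A * (x₁⁻¹ * x₂⁻¹ * x₃⁻¹ * x₄⁻¹ * x₅⁻¹ * x₆⁻¹) := by
    intros; simp only [div_eq_mul_inv, mul_inv]
  simp only [dixonValue, e]
  have hp : (2 : ℂ) ^ (-(b + 1)) = (2 ^ b)⁻¹ / 2 := by
    rw [neg_add', Complex.cpow_sub _ _ two_ne_zero, Complex.cpow_neg]; norm_num
  rw [hp, Complex.cpow_neg, inv_gamma_eq (-a + 1 + b / 2), inv_gamma_eq (b / 2),
    inv_gamma_eq (1 / 2 + b / 2 - c),
    show -a + 1 + b / 2 + 1 = 1 + b / 2 - (a - 1) by ring,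
    show b / 2 + 1 = (1 + (b + 1)) / 2 by ring,
    show 1 / 2 + b / 2 - c + 1 = 1 + (b + 1) / 2 - c by ring,
    show 1 + (b + 1) - c = 1 + b - c + 1 by ring, Complex.Gamma_add_one _ hu0,
    show b / 2 - c + 1 = 1 + b / 2 - c by ring, show b / 2 + 1 / 2 = (1 + b) / 2 by ring,
    show 1 + b - c - (a - 1) = -c - a + b + 2 by ring,
    show 1 + (b + 1) - a = b + 2 - a by ring,
    show 1 + b - (a - 1) = b + 2 - a by ring,
    show b / 2 + 3 / 2 - a = 1 + (b + 1) / 2 - a by ring,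
    show 1 + b / 2 - c - (a - 1) = b / 2 - c - a + 2 by ring,
    show 1 + (b + 1) / 2 - c - a = b / 2 - c - a + 3 / 2 by ring,
    show 1 + b - c + 1 - a = -c - a + b + 2 by ring]
  have h3 : (2 : ℂ) ^ b ≠ 0 := by simp [Complex.cpow_eq_zero_iff]
  generalize (Gamma (1 + b / 2 - (a - 1)))⁻¹ = g1
  generalize (Gamma ((1 + (b + 1)) / 2))⁻¹ = g2
  generalize (Gamma (1 + (b + 1) / 2 - c))⁻¹ = g3
  generalize (Gamma (1 + b / 2 - c))⁻¹ = g4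
  generalize (Gamma ((1 + b) / 2))⁻¹ = g5
  generalize (Gamma (-c - a + b + 2))⁻¹ = g6
  generalize (Gamma (1 + (b + 1) / 2 - a))⁻¹ = g7
  generalize Gamma (b + 2 - a) = g8
  generalize Gamma (1 + b - c) = g9
  generalize Gamma (b / 2 - c - a + 2) = g10
  generalize Gamma (b / 2 - c - a + 3 / 2) = g11
  generalize (2 : ℂ) ^ b = t at *
  field_simp
  ring

/-! ### The series contiguous to Whipple's theorem -/

/-- The sum of `(c - 1 + k) (a)ₖ (b)ₖ (1 - b)ₖ / ((c)ₖ (d)ₖ k!)` with `2 a = c + d - 2`, which is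
`c - 1` times a series of Whipple's form unless `c = 1`. -/
noncomputable def whippleRegValue (b c d : ℂ) : ℂ :=
  Real.pi * 2 ^ (3 - c - d) * Gamma c * Gamma d *
    ((Gamma ((b + c - 1) / 2))⁻¹ * (Gamma ((c - b) / 2))⁻¹ *
      (Gamma ((b + d) / 2))⁻¹ * (Gamma ((1 - b + d) / 2))⁻¹)

/-- The limit in `whipple_tendsto`, with the value in Whipple's theorem put in. -/
lemma mul_whippleValue {b c d : ℂ} (hc : ¬ IsGammaPole c) :
    (b + c - 1) * (c - b) / c * whippleValue b (c + 1) d = whippleRegValue b c d := by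
  have hc0 := ne_zero_of_not_isGammaPole hc
  have hp : (2 : ℂ) ^ (3 - c - d) = 4 * 2 ^ (2 - (c + 1) - d) := by
    rw [show (4 : ℂ) = 2 ^ (2 : ℂ) by norm_num, two_cpow_mul (z := 3 - c - d) (by ring)]
  rw [whippleValue, whippleRegValue, Complex.Gamma_add_one _ hc0, hp,
    inv_gamma_eq ((b + c - 1) / 2), inv_gamma_eq ((c - b) / 2),
    show (b + c - 1) / 2 + 1 = (b + (c + 1)) / 2 by ring,
    show (c - b) / 2 + 1 = (1 - b + (c + 1)) / 2 by ring]
  generalize (Gamma ((b + (c + 1)) / 2))⁻¹ = g1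
  generalize (Gamma ((1 - b + (c + 1)) / 2))⁻¹ = g2
  generalize (Gamma ((b + d) / 2))⁻¹ = g3
  generalize (Gamma ((1 - b + d) / 2))⁻¹ = g4
  field_simp
  ring

lemma whippleValue_eq {b c d : ℂ} (hc : ¬ IsGammaPole c) :
    whippleValue b c d = (b + c) * (c + 1 - b) / (c * (c + 1)) * whippleValue b (c + 2) d := by
  have hc0 := ne_zero_of_not_isGammaPole hc
  have hc1 := ne_zero_of_not_isGammaPole (IsGammaPole.not_add_one hc)
  have hp : (2 : ℂ) ^ (2 - c - d) = 4 * 2 ^ (2 - (c + 2) - d) := by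
    rw [show (4 : ℂ) = 2 ^ (2 : ℂ) by norm_num, two_cpow_mul (z := 2 - c - d) (by ring)]
  rw [whippleValue, whippleValue, gamma_add_two hc, hp,
    inv_gamma_eq ((b + c) / 2), inv_gamma_eq ((1 - b + c) / 2),
    show (b + c) / 2 + 1 = (b + (c + 2)) / 2 by ring,
    show (1 - b + c) / 2 + 1 = (1 - b + (c + 2)) / 2 by ring]
  generalize (Gamma ((b + (c + 2)) / 2))⁻¹ = g1
  generalize (Gamma ((1 - b + (c + 2)) / 2))⁻¹ = g2
  generalize (Gamma ((b + d) / 2))⁻¹ = g3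
  generalize (Gamma ((1 - b + d) / 2))⁻¹ = g4
  field_simp
  ring

lemma tendsto_whippleReg {a b c d : ℂ} (hc : ¬ IsGammaPole c) (hd : ¬ IsGammaPole d)
    (h : 2 * a = c + d - 2) (hT : 0 < a.re ∨ IsGammaPole b ∨ IsGammaPole (1 - b)) :
    Tendsto (fun N => ∑ k ∈ Finset.range N,
      (c - 1 + k) * HypParams.term ⟨a, b, 1 - b, c, d⟩ k) atTop
      (𝓝 (whippleRegValue b c d)) := by
  rw [← mul_whippleValue hc]
  refine whipple_tendsto hc hd h hT (hasSum_whipple (IsGammaPole.not_add_one hc) hd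
    (by linear_combination h) (hT.imp_left fun h => ?_))
  simp
  linarith

lemma IsGammaPole.one_sub_of_neg_add_two {b : ℂ} (h : IsGammaPole (-b + 2)) :
    IsGammaPole (1 - b) := by
  obtain ⟨n, hn⟩ := h
  exact ⟨n + 1, by push_cast; linear_combination hn⟩

lemma mul_poch_succ (x : ℂ) (k : ℕ) : x * poch (x + 1) k = poch x k * (x + k) := by
  rw [← poch_succ, poch_succ_left]

/-- The series `P_{1,0}`, a combination of the two series whose sums are `whippleRegValue b c d` and
`whippleRegValue b d c`. -/
lemma hasSum_whippleContiguous_one_zero {a b c : ℂ} (hc : ¬ IsGammaPole c)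
    (hd : ¬ IsGammaPole (2 * a + 2 - c))
    (h₁ : ¬ IsGammaPole (a - c / 2 + 1 - b / 2)) (h₂ : ¬ IsGammaPole (b / 2 - 1 + c / 2))
    (h₃ : ¬ IsGammaPole (3 / 2 + a - b / 2 - c / 2)) (h₄ : ¬ IsGammaPole (b / 2 + c / 2 - 1 / 2))
    (hb : b ≠ 1) (hca : c ≠ a + 1)
    (hT : 0 < a.re ∨ IsGammaPole b ∨ IsGammaPole (-b + 2)) :
    HasSum (HypParams.term ⟨a, b, -b + 2, c, 2 * a + 2 - c⟩)
      (((1 / 2 * (Gamma (a - c / 2 + 1 - b / 2) * Gamma (b / 2 - 1 + c / 2)) /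
              (Gamma (a + b / 2 - c / 2) * Gamma (-b / 2 + c / 2))
            - 1 / 2 * (Gamma (3 / 2 + a - b / 2 - c / 2) * Gamma (b / 2 + c / 2 - 1 / 2)) /
              (Gamma (a - c / 2 + 1 / 2 + b / 2) * Gamma (-b / 2 + c / 2 + 1 / 2))) *
            Gamma (2 * a + 2 - c) * Gamma c) /
          ((-b + 1) * (-c + a + 1) * Gamma (c + b - 2) * Gamma (2 + 2 * a - b - c))) := by
  have hs : Summable (HypParams.term ⟨a, b, -b + 2, c, 2 * a + 2 - c⟩) := by
    rcases hT with h | h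
    · refine summable_term hc hd ?_
      have e : c + (2 * a + 2 - c) - a - b - (-b + 2) = a := by ring
      simpa only [HypParams.excess, e] using h
    · exact HypParams.Terminates.summable (Or.inr h)
  have hT' : 0 < a.re ∨ IsGammaPole b ∨ IsGammaPole (1 - b) :=
    hT.imp_right (Or.imp_right IsGammaPole.one_sub_of_neg_add_two)
  generalize hD : 2 * a + 2 - c = d at *
  obtain rfl : a = (c + d - 2) / 2 := by rw [← hD]; ring
  have hcd : d - c ≠ 0 := fun h => hca (by linear_combination -h / 2)
  have hb1 : 1 - b ≠ 0 := sub_ne_zero.2 hb.symm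
  have hv₁ := tendsto_whippleReg (a := (c + d - 2) / 2) hc hd (by ring) hT'
  have hv₂ := tendsto_whippleReg (a := (c + d - 2) / 2) hd hc (by ring) hT'
  refine hasSum_of_tendsto_sum_range hs ?_
  have h := ((hv₁.const_mul (d + b - 2)).sub (hv₂.const_mul (c + b - 2))).const_mul
    ((d - c) * (1 - b))⁻¹
  have e : ∀ k, HypParams.term ⟨(c + d - 2) / 2, b, -b + 2, c, d⟩ k = ((d - c) * (1 - b))⁻¹ *
      ((d + b - 2) * ((c - 1 + k) * HypParams.term ⟨(c + d - 2) / 2, b, 1 - b, c, d⟩ k) -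
        (c + b - 2) * ((d - 1 + k) * HypParams.term ⟨(c + d - 2) / 2, b, 1 - b, d, c⟩ k)) := by
    intro k
    rw [eq_inv_mul_iff_mul_eq₀ (mul_ne_zero hcd hb1), term_swap _ _ _ d c]
    have h1 := mul_poch_succ (1 - b) k
    rw [show 1 - b + 1 = -b + 2 by ring] at h1
    have h2 : (1 - b) * HypParams.term ⟨(c + d - 2) / 2, b, -b + 2, c, d⟩ k =
        (1 - b + k) * HypParams.term ⟨(c + d - 2) / 2, b, 1 - b, c, d⟩ k := by
      simp only [term_eq, mul_div_assoc']
      congr 1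
      linear_combination (poch ((c + d - 2) / 2) k * poch b k) * h1
    linear_combination (d - c) * h2
  simp only [Finset.mul_sum, ← Finset.sum_sub_distrib] at h
  simp only [e]
  convert h using 2
  rw [eq_inv_mul_iff_mul_eq₀ (mul_ne_zero hcd hb1)]
  have hz₁ : ¬ IsGammaPole ((d - b) / 2) := by
    rwa [show (d - b) / 2 = (c + d - 2) / 2 - c / 2 + 1 - b / 2 by ring]
  have hz₂ : ¬ IsGammaPole ((d - b + 1) / 2) := by
    rwa [show (d - b + 1) / 2 = 3 / 2 + (c + d - 2) / 2 - b / 2 - c / 2 by ring]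
  have hy₁ : ¬ IsGammaPole ((c + b - 2) / 2) := by
    rwa [show (c + b - 2) / 2 = b / 2 - 1 + c / 2 by ring]
  have hy₂ : ¬ IsGammaPole ((c + b - 2 + 1) / 2) := by
    rwa [show (c + b - 2 + 1) / 2 = b / 2 + c / 2 - 1 / 2 by ring]
  obtain ⟨z₁, z₂⟩ := gamma_half_div hz₁ hz₂
  obtain ⟨y₁, y₂⟩ := gamma_half_div hy₁ hy₂
  have e1 : ∀ x y z w t s u v g : ℂ, (d - c) * (1 - b) *
      (((1 / 2 * (x * y) / (z * w) - 1 / 2 * (t * s) / (u * v)) * Gamma d * Gamma c) /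
        ((-b + 1) * (-c + (c + d - 2) / 2 + 1) * Gamma (c + b - 2) * g)) =
      Gamma d * Gamma c * ((x * g⁻¹) * (y * (Gamma (c + b - 2))⁻¹) * (z⁻¹ * w⁻¹) -
        (t * g⁻¹) * (s * (Gamma (c + b - 2))⁻¹) * (u⁻¹ * v⁻¹)) := by
    intro x y z w t s u v g
    have h1 : (-b + 1) * (-c + (c + d - 2) / 2 + 1) ≠ 0 := by
      rw [show (-b + 1) * (-c + (c + d - 2) / 2 + 1) = (d - c) * (1 - b) / 2 by ring]
      exact div_ne_zero (mul_ne_zero hcd hb1) two_ne_zero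
    have h2 : (d - c) * (1 - b) * ((-b + 1) * (-c + (c + d - 2) / 2 + 1))⁻¹ = 2 := by
      rw [← div_eq_mul_inv, div_eq_iff h1]; ring
    rw [mul_assoc _ (Gamma (c + b - 2)), div_eq_mul_inv _ ((_ * _) * _), mul_inv _ (_ * g),
      mul_inv _ g, div_eq_mul_inv _ (z * w), div_eq_mul_inv _ (u * v), mul_inv z, mul_inv u]
    linear_combination (((1 / 2 * (x * y) * (z⁻¹ * w⁻¹) - 1 / 2 * (t * s) * (u⁻¹ * v⁻¹)) *
      Gamma d * Gamma c) * ((Gamma (c + b - 2))⁻¹ * g⁻¹)) * h2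
  rw [e1, show 2 + 2 * ((c + d - 2) / 2) - b - c = d - b by ring,
    show (c + d - 2) / 2 - c / 2 + 1 - b / 2 = (d - b) / 2 by ring,
    show 3 / 2 + (c + d - 2) / 2 - b / 2 - c / 2 = (d - b + 1) / 2 by ring,
    show b / 2 - 1 + c / 2 = (c + b - 2) / 2 by ring,
    show b / 2 + c / 2 - 1 / 2 = (c + b - 2 + 1) / 2 by ring, z₁, z₂, y₁, y₂,
    whippleRegValue, whippleRegValue,
    inv_gamma_eq ((c + d - 2) / 2 + b / 2 - c / 2), inv_gamma_eq ((c + b - 2) / 2),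
    show (c + d - 2) / 2 + b / 2 - c / 2 + 1 = (b + d) / 2 by ring,
    show (c + b - 2) / 2 + 1 = (b + c) / 2 by ring,
    show (c + d - 2) / 2 - c / 2 + 1 / 2 + b / 2 = (b + d - 1) / 2 by ring,
    show -b / 2 + c / 2 + 1 / 2 = (1 - b + c) / 2 by ring,
    show -b / 2 + c / 2 = (c - b) / 2 by ring,
    show (d - b + 1) / 2 = (1 - b + d) / 2 by ring,
    show (c + b - 2 + 1) / 2 = (b + c - 1) / 2 by ring,
    ← sqrt_pi_mul_self, show 3 - d - c = 3 - c - d by ring]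
  have hp : (2 : ℂ) ^ (1 - (d - b)) * 2 ^ (1 - (c + b - 2)) = 2 * 2 ^ (3 - c - d) := by
    rw [two_cpow_mul (z := 1 + (3 - c - d)) (by ring), Complex.cpow_add _ _ two_ne_zero,
      Complex.cpow_one]
  generalize (Gamma ((c - b) / 2))⁻¹ = g1
  generalize (Gamma ((1 - b + c) / 2))⁻¹ = g2
  generalize (Gamma ((b + c) / 2))⁻¹ = g3
  generalize (Gamma ((b + c - 1) / 2))⁻¹ = g4
  generalize (Gamma ((d - b) / 2))⁻¹ = g5
  generalize (Gamma ((1 - b + d) / 2))⁻¹ = g6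
  generalize (Gamma ((b + d) / 2))⁻¹ = g7
  generalize (Gamma ((b + d - 1) / 2))⁻¹ = g8
  linear_combination ((√Real.pi : ℂ) * √Real.pi * Gamma c * Gamma d *
    (g4 * g6 * g1 * g7 * (d + b - 2) / 2 - g2 * g3 * g5 * g8 * (c + b - 2) / 2)) * hp

/-- The series `P_{-1,1}`, whose sum is the quotient of
`whippleRegValue b c d + whippleRegValue b d c` by `2 (a - 1)`. -/
lemma hasSum_whippleContiguous_neg_one_one {a b c : ℂ} (hc : ¬ IsGammaPole c)
    (hd : ¬ IsGammaPole (2 * a - c)) (ha : ¬ IsGammaPole (a - 1))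
    (h₁ : ¬ IsGammaPole (b / 2 + c / 2 - 1 / 2)) (h₂ : ¬ IsGammaPole (b / 2 + c / 2))
    (hT : 0 < (a - 1).re ∨ IsGammaPole b ∨ IsGammaPole (-b + 1)) :
    HasSum (HypParams.term ⟨a, b, -b + 1, c, 2 * a - c⟩)
      (((√Real.pi : ℂ) * Gamma (a - 1) * Gamma c * Gamma (b / 2 + c / 2 - 1 / 2) /
              (2 ^ (2 * a - b - c) * Gamma a * Gamma (-b / 2 + c / 2 + 1 / 2) *
                Gamma (a - b / 2 - c / 2) * Gamma (a + b / 2 - c / 2 - 1 / 2) * Gamma (c + b - 1))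
            + (√Real.pi : ℂ) * Gamma (b / 2 + c / 2) * Gamma (a - 1) * Gamma c /
              (2 ^ (2 * a - b - c) * Gamma a * Gamma (-b / 2 + c / 2) *
                Gamma (-b / 2 + a - c / 2 + 1 / 2) * Gamma (a + b / 2 - c / 2) *
                Gamma (c + b - 1))) *
          Gamma (2 * a - c)) := by
  rw [show -b + 1 = 1 - b by ring] at *
  have hs : Summable (HypParams.term ⟨a, b, 1 - b, c, 2 * a - c⟩) := by
    rcases hT with h | h
    · refine summable_term hc hd ?_
      have e : c + (2 * a - c) - a - b - (1 - b) = a - 1 := by ring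
      simpa only [HypParams.excess, e] using h
    · exact HypParams.Terminates.summable (Or.inr h)
  have ha0 := ne_zero_of_not_isGammaPole ha
  have hga := gamma_ne_zero ha
  have haG : Gamma a = (a - 1) * Gamma (a - 1) := by
    rw [← Complex.Gamma_add_one _ ha0, sub_add_cancel]
  generalize hD : 2 * a - c = d at *
  have hv₁ := tendsto_whippleReg (a := a - 1) hc hd (by linear_combination hD) hT
  have hv₂ := tendsto_whippleReg (a := a - 1) hd hc (by linear_combination hD) hT
  refine hasSum_of_tendsto_sum_range hs ?_
  have h2a : 2 * (a - 1) ≠ 0 := mul_ne_zero two_ne_zero ha0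
  have h := (hv₁.add hv₂).const_mul (2 * (a - 1))⁻¹
  have e : ∀ k, HypParams.term ⟨a, b, 1 - b, c, d⟩ k = (2 * (a - 1))⁻¹ *
      ((c - 1 + k) * HypParams.term ⟨a - 1, b, 1 - b, c, d⟩ k +
        (d - 1 + k) * HypParams.term ⟨a - 1, b, 1 - b, d, c⟩ k) := by
    intro k
    rw [eq_inv_mul_iff_mul_eq₀ h2a, term_swap _ _ _ d c]
    have h1 := mul_poch_succ (a - 1) k
    rw [sub_add_cancel] at h1
    have h2 : (a - 1) * HypParams.term ⟨a, b, 1 - b, c, d⟩ k =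
        (a - 1 + k) * HypParams.term ⟨a - 1, b, 1 - b, c, d⟩ k := by
      simp only [term_eq, mul_div_assoc']
      congr 1
      linear_combination (poch b k * poch (1 - b) k) * h1
    linear_combination 2 * h2 + HypParams.term ⟨a - 1, b, 1 - b, c, d⟩ k * hD
  simp only [Finset.mul_sum, ← Finset.sum_add_distrib] at h
  simp only [e]
  convert h using 2
  rw [eq_inv_mul_iff_mul_eq₀ h2a]
  have hy₁ : ¬ IsGammaPole ((c + b - 1) / 2) := by
    rwa [show (c + b - 1) / 2 = b / 2 + c / 2 - 1 / 2 by ring]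
  have hy₂ : ¬ IsGammaPole ((c + b - 1 + 1) / 2) := by
    rwa [show (c + b - 1 + 1) / 2 = b / 2 + c / 2 by ring]
  obtain ⟨y₁, y₂⟩ := gamma_half_div hy₁ hy₂
  have e1 : ∀ A x y z w : ℂ, 2 * (a - 1) * (Gamma (a - 1) * A / (w * Gamma a * x * y * z *
      Gamma (c + b - 1))) = 2 * (A * (Gamma (c + b - 1))⁻¹) * (w⁻¹ * x⁻¹ * y⁻¹ * z⁻¹) := by
    intro A x y z w
    rw [haG, div_eq_mul_inv]
    simp only [mul_inv]
    field_simp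
  rw [show (√Real.pi : ℂ) * Gamma (a - 1) * Gamma c * Gamma (b / 2 + c / 2 - 1 / 2) =
      Gamma (a - 1) * (√Real.pi * Gamma c * Gamma (b / 2 + c / 2 - 1 / 2)) by ring,
    show (√Real.pi : ℂ) * Gamma (b / 2 + c / 2) * Gamma (a - 1) * Gamma c =
      Gamma (a - 1) * (√Real.pi * Gamma c * Gamma (b / 2 + c / 2)) by ring,
    ← mul_assoc, mul_add, e1, e1,
    show b / 2 + c / 2 - 1 / 2 = (c + b - 1) / 2 by ring,
    show b / 2 + c / 2 = (c + b - 1 + 1) / 2 by ring,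
    mul_assoc _ (Gamma ((c + b - 1) / 2)), mul_assoc _ (Gamma ((c + b - 1 + 1) / 2)), y₁, y₂,
    whippleRegValue, whippleRegValue,
    show -b / 2 + c / 2 + 1 / 2 = (1 - b + c) / 2 by ring,
    show a - b / 2 - c / 2 = (d - b) / 2 by rw [← hD]; ring,
    show a + b / 2 - c / 2 - 1 / 2 = (b + d - 1) / 2 by rw [← hD]; ring,
    show -b / 2 + c / 2 = (c - b) / 2 by ring,
    show -b / 2 + a - c / 2 + 1 / 2 = (1 - b + d) / 2 by rw [← hD]; ring,
    show a + b / 2 - c / 2 = (b + d) / 2 by rw [← hD]; ring,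
    show (c + b - 1 + 1) / 2 = (b + c) / 2 by ring,
    show (c + b - 1) / 2 = (b + c - 1) / 2 by ring,
    ← sqrt_pi_mul_self, show 3 - d - c = 3 - c - d by ring,
    show 2 * a - b - c = d - b by rw [← hD]; ring]
  have hp : ((2 : ℂ) ^ (d - b))⁻¹ * 2 ^ (1 - (c + b - 1)) * 2 = 2 ^ (3 - c - d) := by
    rw [← Complex.cpow_neg, two_cpow_mul (z := 2 - c - d) (by ring),
      show 3 - c - d = 2 - c - d + 1 by ring, Complex.cpow_add _ _ two_ne_zero, Complex.cpow_one]
  generalize (Gamma ((c - b) / 2))⁻¹ = g1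
  generalize (Gamma ((1 - b + c) / 2))⁻¹ = g2
  generalize (Gamma ((b + c) / 2))⁻¹ = g3
  generalize (Gamma ((b + c - 1) / 2))⁻¹ = g4
  generalize (Gamma ((d - b) / 2))⁻¹ = g5
  generalize (Gamma ((1 - b + d) / 2))⁻¹ = g6
  generalize (Gamma ((b + d) / 2))⁻¹ = g7
  generalize (Gamma ((b + d - 1) / 2))⁻¹ = g8
  linear_combination ((√Real.pi : ℂ) * √Real.pi * Gamma c * Gamma d *
    (g2 * g3 * g5 * g8 + g1 * g4 * g6 * g7)) * hp

lemma isBigO_const_pow_zero (x : ℂ) : (fun _ : ℕ => x) =O[atTop] fun k : ℕ => (k : ℝ) ^ 0 :=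
  IsBigO.of_bound ‖x‖ (by simp)

/-- The series `P_{0,-1}` is half the sum of two series of Whipple's form, which however need not
converge. Shifting these turns them into convergent ones, and the remainders, which need not tend
to zero either, do so when added. -/
lemma whippleContiguous_zero_neg_one_telescope {a b c d : ℂ} (hc : ¬ IsGammaPole c)
    (hd : ¬ IsGammaPole d) (h : 2 * a = c + d - 1) (N : ℕ) :
    2 * c * (c + 1) * ∑ k ∈ Finset.range (N + 1), HypParams.term ⟨a, b, -b, c, d⟩ k =
      (b + c) * (c + 1 - b) *
        ∑ k ∈ Finset.range (N + 1), HypParams.term ⟨a + 1, b, 1 - b, c + 2, d⟩ k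
      + (b + 1 + c) * (c - b) *
        ∑ k ∈ Finset.range (N + 1), HypParams.term ⟨a + 1, b + 1, -b, c + 2, d⟩ k
      + 2 * b ^ 2 * HypParams.term ⟨a + 1, b + 1, 1 - b, c + 2, d⟩ N := by
  have hc1 := IsGammaPole.not_add_one hc
  have hc2 := IsGammaPole.not_add_two hc
  have ec : c + 1 + 1 = c + 2 := by ring
  have hA := whipple_telescope (a := a) (b := b) hc1 hd (by linear_combination h) N
  have hB := whipple_telescope (a := a) (b := b + 1) hc1 hd (by linear_combination h) N
  rw [show 1 - (b + 1) = -b by ring] at hB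
  rw [ec] at hA hB
  have e1 : ∀ k : ℕ, (c + 1 - 1 + k) * HypParams.term ⟨a, b, 1 - b, c + 1, d⟩ k +
      (c + 1 - 1 + k) * HypParams.term ⟨a, b + 1, -b, c + 1, d⟩ k =
      2 * c * HypParams.term ⟨a, b, -b, c, d⟩ k := by
    intro k
    have h1 := mul_poch_succ c k
    have h2 := poch_ne_zero hc k
    have h3 := poch_ne_zero hc1 k
    have h4 := poch_ne_zero hd k
    have hf : (k.factorial : ℂ) ≠ 0 := by exact_mod_cast k.factorial_ne_zero
    have h5 : poch b k * poch (1 - b) k + poch (b + 1) k * poch (-b) k =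
        2 * (poch b k * poch (-b) k) := by
      rcases k with _ | k
      · simp [poch_zero]; norm_num
      · rw [poch_succ_left b, poch_succ_left (-b), show -b + 1 = 1 - b by ring,
          poch_succ (1 - b), poch_succ (b + 1)]
        ring
    simp only [term_eq]
    rw [add_sub_cancel_right]
    field_simp
    linear_combination (-(poch a k) * (poch b k * poch (1 - b) k + poch (b + 1) k * poch (-b) k)) *
      h1 + (c * poch (c + 1) k * poch a k) * h5
  have e2 : (b + N) * (1 - b + N) * HypParams.term ⟨a + 1, b, 1 - b, c + 2, d⟩ N +
      (b + 1 + N) * (-b + N) * HypParams.term ⟨a + 1, b + 1, -b, c + 2, d⟩ N =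
      -(2 * b ^ 2 * HypParams.term ⟨a + 1, b + 1, 1 - b, c + 2, d⟩ N) := by
    have h1 := mul_poch_succ b N
    have h2 := mul_poch_succ (-b) N
    rw [show -b + 1 = 1 - b by ring] at h2
    have h3 := poch_ne_zero hc2 N
    have h4 := poch_ne_zero hd N
    have hf : (N.factorial : ℂ) ≠ 0 := by exact_mod_cast N.factorial_ne_zero
    simp only [term_eq]
    field_simp
    linear_combination (-(1 - b + N) * poch (1 - b) N * poch (a + 1) N) * h1 -
      ((b + 1 + N) * poch (b + 1) N * poch (a + 1) N) * h2
  have e3 : c * (2 * ∑ k ∈ Finset.range (N + 1), HypParams.term ⟨a, b, -b, c, d⟩ k) =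
      ∑ k ∈ Finset.range (N + 1), (c + 1 - 1 + k) * HypParams.term ⟨a, b, 1 - b, c + 1, d⟩ k +
      ∑ k ∈ Finset.range (N + 1), (c + 1 - 1 + k) * HypParams.term ⟨a, b + 1, -b, c + 1, d⟩ k := by
    rw [← Finset.sum_add_distrib, Finset.sum_congr rfl fun k _ => e1 k, ← Finset.mul_sum]
    ring
  linear_combination (c + 1) * e3 + hA + hB - e2

/-- The series `P_{0,-1}`, whose sum is the mean of two values in Whipple's theorem. -/
lemma hasSum_whippleContiguous_zero_neg_one {a b c : ℂ} (hc : ¬ IsGammaPole c)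
    (hd : ¬ IsGammaPole (2 * a - c + 1)) (h₁ : ¬ IsGammaPole (b / 2 + c / 2))
    (h₂ : ¬ IsGammaPole (c / 2 + b / 2 + 1 / 2))
    (hT : 0 < (a + 1).re ∨ IsGammaPole b ∨ IsGammaPole (-b)) :
    HasSum (HypParams.term ⟨a, b, -b, c, 2 * a - c + 1⟩)
      ((√Real.pi : ℂ) * Gamma (2 * a - c + 1) * Gamma c * Gamma (b / 2 + c / 2) /
            (2 ^ (2 * a - c + 1 - b) * Gamma (a - c / 2 + 1 + b / 2) *
              Gamma (-b / 2 + a - c / 2 + 1 / 2) * Gamma (-b / 2 + c / 2) * Gamma (c + b))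
          + (√Real.pi : ℂ) * Gamma (2 * a - c + 1) * Gamma (c / 2 + b / 2 + 1 / 2) * Gamma c /
            (2 ^ (2 * a - c + 1 - b) * Gamma (a - c / 2 + 1 / 2 + b / 2) *
              Gamma (a - c / 2 + 1 - b / 2) * Gamma (-b / 2 + c / 2 + 1 / 2) * Gamma (c + b))) := by
  have hs : Summable (HypParams.term ⟨a, b, -b, c, 2 * a - c + 1⟩) := by
    rcases hT with h | h
    · refine summable_term hc hd ?_
      have e : c + (2 * a - c + 1) - a - b - (-b) = a + 1 := by ring
      simpa only [HypParams.excess, e] using h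
    · exact HypParams.Terminates.summable (Or.inr h)
  generalize hD : 2 * a - c + 1 = d at *
  have hc0 := ne_zero_of_not_isGammaPole hc
  have hc1 := ne_zero_of_not_isGammaPole (IsGammaPole.not_add_one hc)
  have hc2 := IsGammaPole.not_add_two hc
  have hneg : -b + 1 = 1 - b := by ring
  have hW₁ : HasSum (HypParams.term ⟨a + 1, b, 1 - b, c + 2, d⟩) (whippleValue b (c + 2) d) := by
    refine hasSum_whipple hc2 hd (by linear_combination hD) ?_
    rcases hT with h | h | h
    · exact Or.inl h
    · exact Or.inr (Or.inl h)
    · rcases eq_or_ne b 0 with rfl | hb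
      · exact Or.inr (Or.inl (by simpa using h))
      · exact Or.inr (Or.inr (hneg ▸ h.add_one (neg_ne_zero.2 hb)))
  have hW₂ : HasSum (HypParams.term ⟨a + 1, b + 1, -b, c + 2, d⟩)
      (whippleValue (b + 1) (c + 2) d) := by
    rw [show -b = 1 - (b + 1) by ring]
    refine hasSum_whipple hc2 hd (by linear_combination hD) ?_
    rw [show 1 - (b + 1) = -b by ring]
    rcases hT with h | h | h
    · exact Or.inl h
    · rcases eq_or_ne b 0 with rfl | hb
      · exact Or.inr (Or.inr (by simpa using h))
      · exact Or.inr (Or.inl (h.add_one hb))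
    · exact Or.inr (Or.inr h)
  have hG : Tendsto (fun N => 2 * b ^ 2 * HypParams.term ⟨a + 1, b + 1, 1 - b, c + 2, d⟩ N) atTop
      (𝓝 0) := by
    rcases eq_or_ne b 0 with rfl | hb
    · simp
    refine tendsto_mul_term (m := 0) hc2 hd ?_ (isBigO_const_pow_zero _)
    rcases hT with h | h | h
    · left
      have e : c + 2 + d - (a + 1) - (b + 1) - (1 - b) = a := by rw [← hD]; ring
      simp only [HypParams.excess, e]
      simpa using h
    · exact Or.inr (Or.inr (Or.inl (h.add_one hb)))
    · exact Or.inr (Or.inr (Or.inr (hneg ▸ h.add_one (neg_ne_zero.2 hb))))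
  refine hasSum_of_tendsto_sum_range hs ?_
  rw [← tendsto_add_atTop_iff_nat 1]
  have h := ((((tendsto_add_atTop_iff_nat 1).2 hW₁.tendsto_sum_nat).const_mul
    ((b + c) * (c + 1 - b))).add (((tendsto_add_atTop_iff_nat 1).2 hW₂.tendsto_sum_nat).const_mul
    ((b + 1 + c) * (c - b)))).add hG
  simp only [← whippleContiguous_zero_neg_one_telescope (a := a) (b := b) hc hd
    (by linear_combination hD)] at h
  have hden : 2 * c * (c + 1) ≠ 0 := mul_ne_zero (mul_ne_zero two_ne_zero hc0) hc1
  have h' := h.const_mul (2 * c * (c + 1))⁻¹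
  simp only [inv_mul_cancel_left₀ hden] at h'
  convert h' using 2
  have hval : (2 * c * (c + 1))⁻¹ * ((b + c) * (c + 1 - b) * whippleValue b (c + 2) d +
      (b + 1 + c) * (c - b) * whippleValue (b + 1) (c + 2) d + 0) =
      (whippleValue b c d + whippleValue (b + 1) c d) / 2 := by
    rw [whippleValue_eq (b := b) hc, whippleValue_eq (b := b + 1) hc]
    field_simp
    ring
  rw [hval]
  have hy₁ : ¬ IsGammaPole ((c + b) / 2) := by
    rwa [show (c + b) / 2 = b / 2 + c / 2 by ring]
  have hy₂ : ¬ IsGammaPole ((c + b + 1) / 2) := by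
    rwa [show (c + b + 1) / 2 = c / 2 + b / 2 + 1 / 2 by ring]
  obtain ⟨y₁, y₂⟩ := gamma_half_div hy₁ hy₂
  have e1 : ∀ A B w x y z t : ℂ, A * B / (w * x * y * z * t) =
      A * (B * t⁻¹) * (w⁻¹ * x⁻¹ * y⁻¹ * z⁻¹) := by
    intro A B w x y z t
    simp only [div_eq_mul_inv, mul_inv]
    ring
  rw [mul_right_comm (_ * Gamma d) (Gamma (c / 2 + b / 2 + 1 / 2)), e1, e1,
    show b / 2 + c / 2 = (c + b) / 2 by ring,
    show c / 2 + b / 2 + 1 / 2 = (c + b + 1) / 2 by ring, y₁, y₂, whippleValue, whippleValue,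
    show a - c / 2 + 1 + b / 2 = (b + 1 + d) / 2 by rw [← hD]; ring,
    show -b / 2 + a - c / 2 + 1 / 2 = (1 - (b + 1) + d) / 2 by rw [← hD]; ring,
    show -b / 2 + c / 2 + 1 / 2 = (1 - b + c) / 2 by ring,
    show -b / 2 + c / 2 = (1 - (b + 1) + c) / 2 by ring,
    show a - c / 2 + 1 / 2 + b / 2 = (b + d) / 2 by rw [← hD]; ring,
    show a - c / 2 + 1 - b / 2 = (1 - b + d) / 2 by rw [← hD]; ring,
    show (c + b + 1) / 2 = (b + 1 + c) / 2 by ring, show (c + b) / 2 = (b + c) / 2 by ring,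
    ← sqrt_pi_mul_self]
  have hp : ((2 : ℂ) ^ (d - b))⁻¹ * 2 ^ (1 - (c + b)) * 2 = 2 ^ (2 - c - d) := by
    rw [← Complex.cpow_neg, two_cpow_mul (z := 1 - c - d) (by ring),
      show 2 - c - d = 1 - c - d + 1 by ring, Complex.cpow_add _ _ two_ne_zero, Complex.cpow_one]
  generalize (Gamma ((b + 1 + d) / 2))⁻¹ = g1
  generalize (Gamma ((1 - (b + 1) + d) / 2))⁻¹ = g2
  generalize (Gamma ((1 - b + c) / 2))⁻¹ = g3
  generalize (Gamma ((1 - (b + 1) + c) / 2))⁻¹ = g4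
  generalize (Gamma ((b + d) / 2))⁻¹ = g5
  generalize (Gamma ((1 - b + d) / 2))⁻¹ = g6
  generalize (Gamma ((b + 1 + c) / 2))⁻¹ = g7
  generalize (Gamma ((b + c) / 2))⁻¹ = g8
  linear_combination ((√Real.pi : ℂ) * √Real.pi * Gamma c * Gamma d *
    (g7 * g1 * g2 * g4 + g8 * g5 * g6 * g3) / 2) * hp

/-- The series `P_{1,-1}`, times `c - d`, is the difference of two series of Whipple's form, which
however need not converge. Shifting these turns them into convergent ones, and the remainders, which
need not tend to zero either, do so when subtracted. -/
lemma whippleContiguous_one_neg_one_telescope {a b c d : ℂ} (hc : ¬ IsGammaPole c)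
    (hd : ¬ IsGammaPole d) (h : 2 * b = c + d - 2) (N : ℕ) :
    (c - d) * ∑ k ∈ Finset.range (N + 1), HypParams.term ⟨a, -a + 1, b, c, d⟩ k =
      (a + c - 1) * (c - a) / c *
        ∑ k ∈ Finset.range (N + 1), HypParams.term ⟨b + 1, a, 1 - a, c + 1, d⟩ k
      - (a + d - 1) * (d - a) / d *
        ∑ k ∈ Finset.range (N + 1), HypParams.term ⟨b + 1, a, 1 - a, d + 1, c⟩ k
      + (c - d) * a * (1 - a) / (c * d) *
        HypParams.term ⟨b + 1, a + 1, 2 - a, c + 1, d + 1⟩ N := by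
  have hc0 := ne_zero_of_not_isGammaPole hc
  have hd0 := ne_zero_of_not_isGammaPole hd
  have hA := whipple_telescope (a := b) (b := a) hc hd h N
  have hB := whipple_telescope (a := b) (b := a) hd hc (by linear_combination h) N
  have e1 : ∀ k : ℕ, (c - 1 + k) * HypParams.term ⟨b, a, 1 - a, c, d⟩ k -
      (d - 1 + k) * HypParams.term ⟨b, a, 1 - a, d, c⟩ k =
      (c - d) * HypParams.term ⟨a, -a + 1, b, c, d⟩ k := by
    intro k
    rw [term_swap _ _ _ d c]
    have h1 : HypParams.term ⟨a, -a + 1, b, c, d⟩ k = HypParams.term ⟨b, a, 1 - a, c, d⟩ k := by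
      rw [show -a + 1 = 1 - a by ring]
      simp only [term_eq]
      congr 1; ring
    rw [h1]; ring
  have e2 : (a + N) * (1 - a + N) * (HypParams.term ⟨b + 1, a, 1 - a, c + 1, d⟩ N / c -
      HypParams.term ⟨b + 1, a, 1 - a, d + 1, c⟩ N / d) =
      -((c - d) * a * (1 - a) / (c * d) *
        HypParams.term ⟨b + 1, a + 1, 2 - a, c + 1, d + 1⟩ N) := by
    have h1 := mul_poch_succ a N
    have h2 := mul_poch_succ (1 - a) N
    rw [show 1 - a + 1 = 2 - a by ring] at h2
    have h3 := mul_poch_succ c N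
    have h4 := mul_poch_succ d N
    have h5 := poch_ne_zero (IsGammaPole.not_add_one hc) N
    have h6 := poch_ne_zero (IsGammaPole.not_add_one hd) N
    have h7 := poch_ne_zero hc N
    have h8 := poch_ne_zero hd N
    have h9 := add_natCast_ne_zero hc N
    have h10 := add_natCast_ne_zero hd N
    have hf : (N.factorial : ℂ) ≠ 0 := by exact_mod_cast N.factorial_ne_zero
    have hcN : poch (c + 1) N = poch c N * (c + N) / c := by rw [← h3]; field_simp
    have hdN : poch (d + 1) N = poch d N * (d + N) / d := by rw [← h4]; field_simp
    simp only [term_eq, hcN, hdN]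
    field_simp
    linear_combination ((c - d) * (1 - a + N) * poch (1 - a) N * poch (b + 1) N) * h1 +
      ((c - d) * a * poch (a + 1) N * poch (b + 1) N) * h2
  have e3 : (c - d) * ∑ k ∈ Finset.range (N + 1), HypParams.term ⟨a, -a + 1, b, c, d⟩ k =
      ∑ k ∈ Finset.range (N + 1), (c - 1 + k) * HypParams.term ⟨b, a, 1 - a, c, d⟩ k -
      ∑ k ∈ Finset.range (N + 1), (d - 1 + k) * HypParams.term ⟨b, a, 1 - a, d, c⟩ k := by
    rw [← Finset.sum_sub_distrib, Finset.sum_congr rfl fun k _ => e1 k, ← Finset.mul_sum]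
  linear_combination e3 + (eq_inv_mul_iff_mul_eq₀ hc0).2 hA - (eq_inv_mul_iff_mul_eq₀ hd0).2 hB - e2

/-- The series `P_{1,-1}`, whose sum is the quotient of
`whippleRegValue a c d - whippleRegValue a d c` by `c - d`. -/
lemma hasSum_whippleContiguous_one_neg_one {a b c : ℂ} (hc : ¬ IsGammaPole c)
    (hd : ¬ IsGammaPole (-c + 2 + 2 * b)) (hcb : c - 1 - b ≠ 0)
    (hT : 0 < (b + 1).re ∨ IsGammaPole a ∨ IsGammaPole (-a + 1)) :
    HasSum (HypParams.term ⟨a, -a + 1, b, c, -c + 2 + 2 * b⟩)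
      ((-(1 / ((c - 1 - b) * Gamma (1 / 2 + a / 2 - c / 2 + b) * Gamma (-c / 2 - a / 2 + 1 + b) *
              Gamma (c / 2 + a / 2) * Gamma (-a / 2 + c / 2 + 1 / 2)))
            + 1 / ((c - 1 - b) * Gamma (a / 2 - c / 2 + 1 + b) * Gamma (-a / 2 + c / 2) *
              Gamma (-1 / 2 + c / 2 + a / 2) * Gamma (3 / 2 - c / 2 - a / 2 + b))) *
          (Real.pi : ℂ) * 2 ^ (-2 * b) * Gamma (-c + 2 + 2 * b) * Gamma c) := by
  have hs : Summable (HypParams.term ⟨a, -a + 1, b, c, -c + 2 + 2 * b⟩) := by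
    rcases hT with h | h
    · refine summable_term hc hd ?_
      have e : c + (-c + 2 + 2 * b) - a - (-a + 1) - b = b + 1 := by ring
      simpa only [HypParams.excess, e] using h
    · exact HypParams.Terminates.summable (h.imp_right Or.inl)
  generalize hD : -c + 2 + 2 * b = d at *
  have hcd : c - d ≠ 0 := fun h => hcb (by linear_combination h / 2 - hD / 2)
  have hneg : -a + 1 = 1 - a := by ring
  have hc1 := IsGammaPole.not_add_one hc
  have hd1 := IsGammaPole.not_add_one hd
  have hT' : 0 < (b + 1).re ∨ IsGammaPole a ∨ IsGammaPole (1 - a) := hneg ▸ hT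
  have hW₁ : HasSum (HypParams.term ⟨b + 1, a, 1 - a, c + 1, d⟩) (whippleValue a (c + 1) d) :=
    hasSum_whipple hc1 hd (by linear_combination hD) hT'
  have hW₂ : HasSum (HypParams.term ⟨b + 1, a, 1 - a, d + 1, c⟩) (whippleValue a (d + 1) c) :=
    hasSum_whipple hd1 hc (by linear_combination hD) hT'
  have hG : Tendsto (fun N => (c - d) * a * (1 - a) / (c * d) *
      HypParams.term ⟨b + 1, a + 1, 2 - a, c + 1, d + 1⟩ N) atTop (𝓝 0) := by
    rcases eq_or_ne a 0 with rfl | ha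
    · simp
    rcases eq_or_ne (1 - a) 0 with ha' | ha'
    · simp [ha']
    refine tendsto_mul_term (m := 0) hc1 hd1 ?_ (isBigO_const_pow_zero _)
    rcases hT' with h | h | h
    · left
      have e : c + 1 + (d + 1) - (b + 1) - (a + 1) - (2 - a) = b := by rw [← hD]; ring
      simp only [HypParams.excess, e]
      simpa using h
    · exact Or.inr (Or.inr (Or.inl (h.add_one ha)))
    · refine Or.inr (Or.inr (Or.inr ?_))
      have := h.add_one ha'
      rwa [show 1 - a + 1 = 2 - a by ring] at this
  refine hasSum_of_tendsto_sum_range hs ?_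
  rw [← tendsto_add_atTop_iff_nat 1]
  have h := ((((tendsto_add_atTop_iff_nat 1).2 hW₁.tendsto_sum_nat).const_mul
    ((a + c - 1) * (c - a) / c)).sub
    (((tendsto_add_atTop_iff_nat 1).2 hW₂.tendsto_sum_nat).const_mul
      ((a + d - 1) * (d - a) / d))).add hG
  simp only [← whippleContiguous_one_neg_one_telescope (a := a) (b := b) hc hd
    (by linear_combination hD)] at h
  have h' := h.const_mul (c - d)⁻¹
  simp only [inv_mul_cancel_left₀ hcd, mul_whippleValue hc, mul_whippleValue hd] at h'
  convert h' using 2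
  rw [eq_inv_mul_iff_mul_eq₀ hcd]
  have e1 : ∀ x y z w : ℂ, 1 / ((c - 1 - b) * x * y * z * w) =
      2 * (c - d)⁻¹ * (x⁻¹ * y⁻¹ * z⁻¹ * w⁻¹) := by
    intro x y z w
    rw [show c - 1 - b = (c - d) / 2 by rw [← hD]; ring]
    simp only [div_eq_mul_inv, mul_inv, inv_inv]
    ring
  have hp : (2 : ℂ) ^ (-2 * b) * 2 = 2 ^ (3 - c - d) := by
    rw [show 3 - c - d = -2 * b + 1 by rw [← hD]; ring, Complex.cpow_add _ _ two_ne_zero,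
      Complex.cpow_one]
  rw [e1, e1, whippleRegValue, whippleRegValue, show 3 - d - c = 3 - c - d by ring, ← hp,
    show 1 / 2 + a / 2 - c / 2 + b = (a + d - 1) / 2 by rw [← hD]; ring,
    show -c / 2 - a / 2 + 1 + b = (d - a) / 2 by rw [← hD]; ring,
    show c / 2 + a / 2 = (a + c) / 2 by ring,
    show -a / 2 + c / 2 + 1 / 2 = (1 - a + c) / 2 by ring,
    show a / 2 - c / 2 + 1 + b = (a + d) / 2 by rw [← hD]; ring,
    show -a / 2 + c / 2 = (c - a) / 2 by ring,
    show -1 / 2 + c / 2 + a / 2 = (a + c - 1) / 2 by ring,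
    show 3 / 2 - c / 2 - a / 2 + b = (1 - a + d) / 2 by rw [← hD]; ring]
  generalize (Gamma ((a + d - 1) / 2))⁻¹ = g1
  generalize (Gamma ((d - a) / 2))⁻¹ = g2
  generalize (Gamma ((a + c) / 2))⁻¹ = g3
  generalize (Gamma ((1 - a + c) / 2))⁻¹ = g4
  generalize (Gamma ((a + d) / 2))⁻¹ = g5
  generalize (Gamma ((c - a) / 2))⁻¹ = g6
  generalize (Gamma ((a + c - 1) / 2))⁻¹ = g7
  generalize (Gamma ((1 - a + d) / 2))⁻¹ = g8
  generalize (2 : ℂ) ^ (-2 * b) = t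
  field_simp
  ring

/-! ### The domains and the analyticity of the closed forms -/

/-- An open set of which every complex line through two of its points meets the complement in a
countable set only, such as the complement of a locally finite union of complex hyperplanes. -/
def IsLineDense (U : Set (ℂ × ℂ × ℂ)) : Prop :=
  IsOpen U ∧ ∀ x ∈ U, ∀ y ∈ U, {t : ℂ | x + t • (y - x) ∉ U}.Countable

lemma IsLineDense.inter {U V : Set (ℂ × ℂ × ℂ)} (hU : IsLineDense U) (hV : IsLineDense V) :
    IsLineDense (U ∩ V) := by
  refine ⟨hU.1.inter hV.1, fun x hx y hy => ?_⟩
  refine ((hU.2 x hx.1 y hy.1).union (hV.2 x hx.2 y hy.2)).mono fun t ht => ?_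
  by_contra h
  simp only [Set.mem_union, Set.mem_ofPred_eq, not_or, not_not] at h
  exact ht ⟨h.1, h.2⟩

/-- Two points are joined inside `U` by the complex line through them, from which a countable set
is removed. -/
lemma IsLineDense.isConnected {U : Set (ℂ × ℂ × ℂ)} (hU : IsLineDense U) (hne : U.Nonempty) :
    IsConnected U := by
  refine ⟨hne, isPreconnected_of_forall_pair fun x hx y hy => ?_⟩
  have hc : IsConnected ({t : ℂ | x + t • (y - x) ∉ U}ᶜ) :=
    (hU.2 x hx y hy).isConnected_compl_of_one_lt_rank (by simp)
  refine ⟨(fun t : ℂ => x + t • (y - x)) '' {t : ℂ | x + t • (y - x) ∉ U}ᶜ, ?_, ⟨0, ?_⟩, ⟨1, ?_⟩,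
    hc.isPreconnected.image _ (by fun_prop)⟩
  · rintro _ ⟨t, ht, rfl⟩
    simpa using ht
  · simpa using hx
  · simpa using hy

lemma isClosed_isGammaPole : IsClosed {z : ℂ | IsGammaPole z} := by
  have e : {z : ℂ | IsGammaPole z} = Set.range (fun n : ℕ => -(n : ℂ)) := by
    ext z
    simp [IsGammaPole, eq_comm]
  rw [e]
  have h : Topology.IsClosedEmbedding ((↑) : ℕ → ℂ) :=
    Complex.isometry_ofReal.isClosedEmbedding.comp Nat.isClosedEmbedding_coe_real
  exact ((Homeomorph.neg ℂ).isClosedEmbedding.comp h).isClosed_range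

/-- The points at which an affine function avoids a closed countable set of values. -/
lemma isLineDense_of_affine {S : Set ℂ} (hS : IsClosed S) (hS' : S.Countable)
    (ℓ : ℂ × ℂ × ℂ → ℂ) (hℓ : Continuous ℓ)
    (h : ∀ (x y : ℂ × ℂ × ℂ) (t : ℂ), ℓ (x + t • (y - x)) = ℓ x + t * (ℓ y - ℓ x)) :
    IsLineDense {x | ℓ x ∉ S} := by
  refine ⟨(hS.preimage hℓ).isOpen_compl, fun x hx y hy => ?_⟩
  simp only [Set.mem_ofPred_eq, not_not, h] at hx ⊢
  rcases eq_or_ne (ℓ y - ℓ x) 0 with h0 | h0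
  · simp [h0, hx]
  · refine Set.Countable.preimage_of_injOn hS' (f := fun t : ℂ => ℓ x + t * (ℓ y - ℓ x)) ?_
    intro s _ t _ hst
    exact mul_right_cancel₀ h0 (add_left_cancel hst)

lemma isLineDense_not_isGammaPole (ℓ : ℂ × ℂ × ℂ → ℂ) (hℓ : Continuous ℓ)
    (h : ∀ (x y : ℂ × ℂ × ℂ) (t : ℂ), ℓ (x + t • (y - x)) = ℓ x + t * (ℓ y - ℓ x)) :
    IsLineDense {x | ¬ IsGammaPole (ℓ x)} := by
  refine isLineDense_of_affine isClosed_isGammaPole ?_ ℓ hℓ h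
  refine (Set.countable_range fun n : ℕ => -(n : ℂ)).mono ?_
  rintro z ⟨n, rfl⟩
  exact ⟨n, rfl⟩

lemma isLineDense_ne (ℓ m : ℂ × ℂ × ℂ → ℂ) (hℓ : Continuous fun x => ℓ x - m x)
    (h : ∀ (x y : ℂ × ℂ × ℂ) (t : ℂ), ℓ (x + t • (y - x)) - m (x + t • (y - x)) =
      ℓ x - m x + t * (ℓ y - m y - (ℓ x - m x))) :
    IsLineDense {x | ℓ x ≠ m x} := by
  have := isLineDense_of_affine isClosed_singleton (Set.countable_singleton 0)
    (fun x => ℓ x - m x) hℓ h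
  simpa [sub_eq_zero] using this

@[fun_prop]
lemma analyticAt_gamma_comp {f : ℂ × ℂ × ℂ → ℂ} {x : ℂ × ℂ × ℂ} (hf : AnalyticAt ℂ f x)
    (h : ¬ IsGammaPole (f x)) : AnalyticAt ℂ (fun y => Gamma (f y)) x := by
  have hG : AnalyticAt ℂ Gamma (f x) := by
    refine DifferentiableOn.analyticAt (s := {z | ¬ IsGammaPole z}) (fun z hz => ?_)
      (isClosed_isGammaPole.isOpen_compl.mem_nhds h)
    exact (Complex.differentiableAt_Gamma z fun m hm => hz ⟨m, hm⟩).differentiableWithinAt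
  exact hG.comp hf

/-- The reciprocal of the gamma function, `0` at the poles of the gamma function. -/
noncomputable def invGamma (z : ℂ) : ℂ := (Gamma z)⁻¹

@[fun_prop]
lemma analyticAt_invGamma_comp {f : ℂ × ℂ × ℂ → ℂ} {x : ℂ × ℂ × ℂ} (hf : AnalyticAt ℂ f x) :
    AnalyticAt ℂ (fun y => invGamma (f y)) x := by
  have hG : AnalyticAt ℂ invGamma (f x) :=
    Complex.differentiable_one_div_Gamma.analyticAt _
  exact hG.comp hf

lemma inv_gamma_eq_invGamma (z : ℂ) : (Gamma z)⁻¹ = invGamma z := rfl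

attribute [fun_prop] analyticAt_fst analyticAt_snd

lemma not_isGammaPole_of_re_pos {z : ℂ} (h : 0 < z.re) : ¬ IsGammaPole z := by
  rintro ⟨n, rfl⟩
  exact absurd h (by simp)

/-- The topological part of `IsClosedForm` follows from `IsLineDense`, once a point of the domain
with excess of positive real part is known. -/
lemma isClosedForm_of_isLineDense {P : ℂ → ℂ → ℂ → HypParams} {D T : ℂ → ℂ → ℂ → Prop}
    {R : ℂ → ℂ → ℂ → ℂ} (hU : IsLineDense {x : ℂ × ℂ × ℂ | D x.1 x.2.1 x.2.2})
    {a b c : ℂ} (hD : D a b c) (hs : 0 < (P a b c).excess.re)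
    (hR : ∀ a b c, D a b c → 0 < (P a b c).excess.re ∨ T a b c → HasSum (P a b c).term (R a b c))
    (hA : AnalyticOnNhd ℂ (fun x : ℂ × ℂ × ℂ => R x.1 x.2.1 x.2.2)
      {x : ℂ × ℂ × ℂ | D x.1 x.2.1 x.2.2}) :
    IsClosedForm P D T R :=
  ⟨hR, hU.1, hU.isConnected ⟨(a, b, c), hD⟩, ⟨a, b, c, hD, hs⟩, hA⟩

theorem mainTheorem2 :
    -- the element `X_{0,1}` contiguous to Dixon's theorem
    ((∀ a b c : ℂ, (⟨a, b, c, b + 2 - a, 1 + b - c⟩ : HypParams).term =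
        (dixonElement b c a 0 1).term) ∧
      IsClosedForm (fun a b c => ⟨a, b, c, b + 2 - a, 1 + b - c⟩)
        (fun a b c => ¬ IsGammaPole (b + 2 - a) ∧ ¬ IsGammaPole (1 + b - c) ∧
          ¬ IsGammaPole (b / 2 - c - a + 2) ∧ ¬ IsGammaPole (b / 2 - c - a + 3 / 2) ∧ a ≠ 1)
        (fun a b c => IsGammaPole a ∨ IsGammaPole b ∨ IsGammaPole c)
        (fun a b c =>
          -(Gamma (b + 2 - a) * Gamma (1 + b - c) * Gamma (b / 2 - c - a + 2) * (√Real.pi : ℂ) /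
            (Gamma (-a + 1 + b / 2) * Gamma (b / 2 - c + 1) * Gamma (b / 2 + 1 / 2) * (a - 1) *
              Gamma (-c - a + b + 2) * 2 ^ b))
          + Gamma (b + 2 - a) * Gamma (1 + b - c) * Gamma (b / 2 - c - a + 3 / 2) *
              (√Real.pi : ℂ) /
            ((a - 1) * Gamma (-c - a + b + 2) * Gamma (b / 2) * Gamma (b / 2 + 3 / 2 - a) * 2 ^ b *
              Gamma (1 / 2 + b / 2 - c)))) ∧
    -- the element `P_{1,0}` contiguous to Whipple's theorem
    ((∀ a b c : ℂ, (⟨a, b, -b + 2, c, 2 * a + 2 - c⟩ : HypParams).term =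
        (whippleElement a b c 1 0).term) ∧
      IsClosedForm (fun a b c => ⟨a, b, -b + 2, c, 2 * a + 2 - c⟩)
        (fun a b c => ¬ IsGammaPole c ∧ ¬ IsGammaPole (2 * a + 2 - c) ∧
          ¬ IsGammaPole (a - c / 2 + 1 - b / 2) ∧ ¬ IsGammaPole (b / 2 - 1 + c / 2) ∧
          ¬ IsGammaPole (3 / 2 + a - b / 2 - c / 2) ∧ ¬ IsGammaPole (b / 2 + c / 2 - 1 / 2) ∧
          b ≠ 1 ∧ c ≠ a + 1)
        (fun _ b _ => IsGammaPole b ∨ IsGammaPole (-b + 2))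
        (fun a b c =>
          ((1 / 2 * (Gamma (a - c / 2 + 1 - b / 2) * Gamma (b / 2 - 1 + c / 2)) /
              (Gamma (a + b / 2 - c / 2) * Gamma (-b / 2 + c / 2))
            - 1 / 2 * (Gamma (3 / 2 + a - b / 2 - c / 2) * Gamma (b / 2 + c / 2 - 1 / 2)) /
              (Gamma (a - c / 2 + 1 / 2 + b / 2) * Gamma (-b / 2 + c / 2 + 1 / 2))) *
            Gamma (2 * a + 2 - c) * Gamma c) /
          ((-b + 1) * (-c + a + 1) * Gamma (c + b - 2) * Gamma (2 + 2 * a - b - c)))) ∧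
    -- the element `P_{-1,1}` contiguous to Whipple's theorem
    ((∀ a b c : ℂ, (⟨a, b, -b + 1, c, 2 * a - c⟩ : HypParams).term =
        (whippleElement a b c (-1) 1).term) ∧
      IsClosedForm (fun a b c => ⟨a, b, -b + 1, c, 2 * a - c⟩)
        (fun a b c => ¬ IsGammaPole c ∧ ¬ IsGammaPole (2 * a - c) ∧ ¬ IsGammaPole (a - 1) ∧
          ¬ IsGammaPole (b / 2 + c / 2 - 1 / 2) ∧ ¬ IsGammaPole (b / 2 + c / 2))
        (fun _ b _ => IsGammaPole b ∨ IsGammaPole (-b + 1))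
        (fun a b c =>
          ((√Real.pi : ℂ) * Gamma (a - 1) * Gamma c * Gamma (b / 2 + c / 2 - 1 / 2) /
              (2 ^ (2 * a - b - c) * Gamma a * Gamma (-b / 2 + c / 2 + 1 / 2) *
                Gamma (a - b / 2 - c / 2) * Gamma (a + b / 2 - c / 2 - 1 / 2) * Gamma (c + b - 1))
            + (√Real.pi : ℂ) * Gamma (b / 2 + c / 2) * Gamma (a - 1) * Gamma c /
              (2 ^ (2 * a - b - c) * Gamma a * Gamma (-b / 2 + c / 2) *
                Gamma (-b / 2 + a - c / 2 + 1 / 2) * Gamma (a + b / 2 - c / 2) *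
                Gamma (c + b - 1))) *
          Gamma (2 * a - c))) ∧
    -- the element `P_{0,-1}` contiguous to Whipple's theorem
    ((∀ a b c : ℂ, (⟨a, b, -b, c, 2 * a - c + 1⟩ : HypParams).term =
        (whippleElement a b c 0 (-1)).term) ∧
      IsClosedForm (fun a b c => ⟨a, b, -b, c, 2 * a - c + 1⟩)
        (fun a b c => ¬ IsGammaPole c ∧ ¬ IsGammaPole (2 * a - c + 1) ∧
          ¬ IsGammaPole (b / 2 + c / 2) ∧ ¬ IsGammaPole (c / 2 + b / 2 + 1 / 2))
        (fun _ b _ => IsGammaPole b ∨ IsGammaPole (-b))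
        (fun a b c =>
          (√Real.pi : ℂ) * Gamma (2 * a - c + 1) * Gamma c * Gamma (b / 2 + c / 2) /
            (2 ^ (2 * a - c + 1 - b) * Gamma (a - c / 2 + 1 + b / 2) *
              Gamma (-b / 2 + a - c / 2 + 1 / 2) * Gamma (-b / 2 + c / 2) * Gamma (c + b))
          + (√Real.pi : ℂ) * Gamma (2 * a - c + 1) * Gamma (c / 2 + b / 2 + 1 / 2) * Gamma c /
            (2 ^ (2 * a - c + 1 - b) * Gamma (a - c / 2 + 1 / 2 + b / 2) *
              Gamma (a - c / 2 + 1 - b / 2) * Gamma (-b / 2 + c / 2 + 1 / 2) * Gamma (c + b)))) ∧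
    -- the element `P_{1,-1}` contiguous to Whipple's theorem
    ((∀ a b c : ℂ, (⟨a, -a + 1, b, c, -c + 2 + 2 * b⟩ : HypParams).term =
        (whippleElement b a c 1 (-1)).term) ∧
      IsClosedForm (fun a b c => ⟨a, -a + 1, b, c, -c + 2 + 2 * b⟩)
        (fun _ b c => ¬ IsGammaPole c ∧ ¬ IsGammaPole (-c + 2 + 2 * b) ∧ c - 1 - b ≠ 0)
        (fun a _ _ => IsGammaPole a ∨ IsGammaPole (-a + 1))
        (fun a b c =>
          (-(1 / ((c - 1 - b) * Gamma (1 / 2 + a / 2 - c / 2 + b) * Gamma (-c / 2 - a / 2 + 1 + b) *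
              Gamma (c / 2 + a / 2) * Gamma (-a / 2 + c / 2 + 1 / 2)))
            + 1 / ((c - 1 - b) * Gamma (a / 2 - c / 2 + 1 + b) * Gamma (-a / 2 + c / 2) *
              Gamma (-1 / 2 + c / 2 + a / 2) * Gamma (3 / 2 - c / 2 - a / 2 + b))) *
          (Real.pi : ℂ) * 2 ^ (-2 * b) * Gamma (-c + 2 + 2 * b) * Gamma c)) := by
  refine ⟨?_, ?_, ?_, ?_, ?_⟩
  · refine ⟨fun a b c => ?_, isClosedForm_of_isLineDense ?_ (a := 0) (b := 0) (c := 0) ?_ ?_ ?_ ?_⟩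
    · ext k
      simp only [HypParams.term, dixonElement]
      push_cast
      ring_nf
    · refine (isLineDense_not_isGammaPole _ ?_ ?_).inter <|
        (isLineDense_not_isGammaPole _ ?_ ?_).inter <|
        (isLineDense_not_isGammaPole _ ?_ ?_).inter <|
        (isLineDense_not_isGammaPole _ ?_ ?_).inter <|
        isLineDense_ne _ _ ?_ ?_
      all_goals first | fun_prop | (intro x y t; simp; ring)
    · refine ⟨?_, ?_, ?_, ?_, ?_⟩
      all_goals first | exact not_isGammaPole_of_re_pos (by norm_num) | norm_num
    · norm_num [HypParams.excess]
    · rintro a b c ⟨hv, hu, h₁, h₂, ha⟩ hT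
      refine hasSum_dixonContiguous hv hu h₁ h₂ ha (hT.imp_left fun h => ?_)
      have e : HypParams.excess ⟨a, b, c, b + 2 - a, 1 + b - c⟩ = 3 + b - 2 * a - 2 * c := by
        simp only [HypParams.excess]; ring
      rwa [e] at h
    · rintro x ⟨hv, hu, h₁, h₂, ha⟩
      replace ha := sub_ne_zero.2 ha
      -- The reciprocal `invGamma` is entire, so only gamma functions in numerators and linear
      -- factors in denominators give rise to side conditions, which hold in the domain.
      simp only [div_eq_mul_inv, mul_inv, ← Complex.cpow_neg, inv_gamma_eq_invGamma] at *
      fun_prop (disch := first | assumption | simp)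
  · refine ⟨fun a b c => ?_, isClosedForm_of_isLineDense ?_ (a := 3) (b := 0) (c := 3) ?_ ?_ ?_ ?_⟩
    · simp only [whippleElement]
      push_cast
      ring_nf
    · refine (isLineDense_not_isGammaPole _ ?_ ?_).inter <|
        (isLineDense_not_isGammaPole _ ?_ ?_).inter <|
        (isLineDense_not_isGammaPole _ ?_ ?_).inter <|
        (isLineDense_not_isGammaPole _ ?_ ?_).inter <|
        (isLineDense_not_isGammaPole _ ?_ ?_).inter <|
        (isLineDense_not_isGammaPole _ ?_ ?_).inter <|
        (isLineDense_ne _ _ ?_ ?_).inter <|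
        isLineDense_ne _ _ ?_ ?_
      all_goals first | fun_prop | (intro x y t; simp <;> ring)
    · refine ⟨?_, ?_, ?_, ?_, ?_, ?_, ?_, ?_⟩
      all_goals first | exact not_isGammaPole_of_re_pos (by norm_num) | norm_num
    · norm_num [HypParams.excess]
    · rintro a b c ⟨hc, hd, h₁, h₂, h₃, h₄, hb, hca⟩ hT
      refine hasSum_whippleContiguous_one_zero hc hd h₁ h₂ h₃ h₄ hb hca (hT.imp_left fun h => ?_)
      have e : HypParams.excess ⟨a, b, -b + 2, c, 2 * a + 2 - c⟩ = a := by
        simp only [HypParams.excess]; ring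
      rwa [e] at h
    · rintro x ⟨hc, hd, h₁, h₂, h₃, h₄, hb, hca⟩
      have hb' : -x.2.1 + 1 ≠ 0 := fun h => hb (by linear_combination -h)
      have hca' : -x.2.2 + x.1 + 1 ≠ 0 := fun h => hca (by linear_combination -h)
      simp only [div_eq_mul_inv, mul_inv, inv_gamma_eq_invGamma] at *
      fun_prop (disch := first | assumption | simp)
  · refine ⟨fun a b c => ?_, isClosedForm_of_isLineDense ?_ (a := 3) (b := 0) (c := 2) ?_ ?_ ?_ ?_⟩
    · simp only [whippleElement]
      push_cast
      ring_nf
    · refine (isLineDense_not_isGammaPole _ ?_ ?_).inter <|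
        (isLineDense_not_isGammaPole _ ?_ ?_).inter <|
        (isLineDense_not_isGammaPole _ ?_ ?_).inter <|
        (isLineDense_not_isGammaPole _ ?_ ?_).inter <|
        isLineDense_not_isGammaPole _ ?_ ?_
      all_goals first | fun_prop | (intro x y t; simp <;> ring)
    · refine ⟨?_, ?_, ?_, ?_, ?_⟩
      all_goals exact not_isGammaPole_of_re_pos (by norm_num)
    · norm_num [HypParams.excess]
    · rintro a b c ⟨hc, hd, ha, h₁, h₂⟩ hT
      refine hasSum_whippleContiguous_neg_one_one hc hd ha h₁ h₂ (hT.imp_left fun h => ?_)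
      have e : HypParams.excess ⟨a, b, -b + 1, c, 2 * a - c⟩ = a - 1 := by
        simp only [HypParams.excess]; ring
      rwa [e] at h
    · rintro x ⟨hc, hd, ha, h₁, h₂⟩
      simp only [div_eq_mul_inv, mul_inv, ← Complex.cpow_neg, inv_gamma_eq_invGamma] at *
      fun_prop (disch := first | assumption | simp)
  · refine ⟨fun a b c => ?_, isClosedForm_of_isLineDense ?_ (a := 1) (b := 0) (c := 1) ?_ ?_ ?_ ?_⟩
    · simp only [whippleElement]
      push_cast
      ring_nf
    · refine (isLineDense_not_isGammaPole _ ?_ ?_).inter <|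
        (isLineDense_not_isGammaPole _ ?_ ?_).inter <|
        (isLineDense_not_isGammaPole _ ?_ ?_).inter <|
        isLineDense_not_isGammaPole _ ?_ ?_
      all_goals first | fun_prop | (intro x y t; simp <;> ring)
    · refine ⟨?_, ?_, ?_, ?_⟩
      all_goals exact not_isGammaPole_of_re_pos (by norm_num)
    · norm_num [HypParams.excess]
    · rintro a b c ⟨hc, hd, h₁, h₂⟩ hT
      refine hasSum_whippleContiguous_zero_neg_one hc hd h₁ h₂ (hT.imp_left fun h => ?_)
      have e : HypParams.excess ⟨a, b, -b, c, 2 * a - c + 1⟩ = a + 1 := by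
        simp only [HypParams.excess]; ring
      rwa [e] at h
    · rintro x ⟨hc, hd, h₁, h₂⟩
      simp only [div_eq_mul_inv, mul_inv, ← Complex.cpow_neg, inv_gamma_eq_invGamma] at *
      fun_prop (disch := first | assumption | simp)
  · refine ⟨fun a b c => ?_, isClosedForm_of_isLineDense ?_ (a := 0) (b := 1) (c := 1) ?_ ?_ ?_ ?_⟩
    · ext k
      simp only [HypParams.term, whippleElement]
      push_cast
      ring_nf
    · refine (isLineDense_not_isGammaPole _ ?_ ?_).inter <|
        (isLineDense_not_isGammaPole _ ?_ ?_).inter <|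
        isLineDense_ne _ _ ?_ ?_
      all_goals first | fun_prop | (intro x y t; simp <;> ring)
    · refine ⟨?_, ?_, ?_⟩
      all_goals first | exact not_isGammaPole_of_re_pos (by norm_num) | norm_num
    · norm_num [HypParams.excess]
    · rintro a b c ⟨hc, hd, hcb⟩ hT
      refine hasSum_whippleContiguous_one_neg_one hc hd hcb (hT.imp_left fun h => ?_)
      have e : HypParams.excess ⟨a, -a + 1, b, c, -c + 2 + 2 * b⟩ = b + 1 := by
        simp only [HypParams.excess]; ring
      rwa [e] at h
    · rintro x ⟨hc, hd, hcb⟩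
      simp only [div_eq_mul_inv, mul_inv, inv_gamma_eq_invGamma] at *
      fun_prop (disch := first | assumption | simp)
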